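/- Let $\omega = 2\int_0^1 (1+\tau^4)^{-1/2}\,d\tau$. There is a lattice in $\mathbb{C}$ with invariants $g_2=1$, $g_3=0$, and any such lattice equals $2\omega\mathbb{Z}+2i\omega\mathbb{Z}$; let $\wp$ be its Weierstrass function (the lemniscatic $\wp$). Let $U\subseteq\mathbb{C}$ be a connected open set containing $0$ and let $s,c$ be holomorphic functions on $U$ that satisfy $$s' = c^3,\qquad c' = -s^3,\qquad s(0)=0,\qquad c(0)=1 .$$ Then each of the functions $sc$, $c^2$ and $s^2$ extends from $U$ to an elliptic function on $\mathbb{C}$ having $2\omega$ and $2i\omega$ among its periods. Each of these three elliptic functions has poles exactly at the points congruent to $\tfrac12(\pm1\pm i)\omega$ (independent signs) modulo $2\omega$ and $2i\omega$, and all these poles are simple. Moreover $$sc = -\frac12\,\frac{\wp'}{\wp^2+1/4}$$ as an identity of meromorphic functions: off the lattice, it holds for the elliptic extension of $sc$ wherever $\wp^2+1/4\neq0$, and it holds for $sc$ itself at every point of $U$ off the lattice, $\wp^2+1/4$ being nonzero there. -/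

import Mathlib

namespace Lemniscatic

/-- The real half-period `ω = 2 ∫₀¹ dτ / (1 + τ⁴)^(1/2) = 1.85407…`. -/
noncomputable def omega : ℝ := 2 * ∫ τ in (0 : ℝ)..1, 1 / Real.sqrt (1 + τ ^ 4)

/-- The holomorphic functions `s`, `c` solve the initial value problem
`s' = c³`, `c' = -s³`, `s(0) = 0`, `c(0) = 1` on `U`. -/
structure IsIVPSolution (U : Set ℂ) (s c : ℂ → ℂ) : Prop where
  hasDerivAt_s : ∀ z ∈ U, HasDerivAt s (c z ^ 3) z
  hasDerivAt_c : ∀ z ∈ U, HasDerivAt c (-(s z) ^ 3) z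
  s_zero : s 0 = 0
  c_zero : c 0 = 1

/-- `f` is an elliptic function having `ω₁`, `ω₂` among its periods (they need not generate the
group of all periods): `ω₁`, `ω₂` are linearly independent over `ℝ`, and `f` is meromorphic in the
whole plane and invariant under translation by either of them. A meromorphic function is
represented by the function that is holomorphic away from its poles (all removable singularities
are removed) and has the conventional value `0` at its poles; this is Mathlib's normal form. -/
structure IsElliptic (ω₁ ω₂ : ℂ) (f : ℂ → ℂ) : Prop where
  indep : LinearIndependent ℝ ![ω₁, ω₂]
  meromorphic : MeromorphicNFOn f Set.univ
  periodic₁ : Function.Periodic f ω₁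
  periodic₂ : Function.Periodic f ω₂

/-- The set of poles of `f` is exactly `S`, and each of these poles is simple. -/
def HasSimplePolesExactlyAt (f : ℂ → ℂ) (S : Set ℂ) : Prop :=
  (∀ p, meromorphicOrderAt f p < 0 ↔ p ∈ S) ∧ ∀ p ∈ S, meromorphicOrderAt f p = -1

/-- The points congruent to one of `½ (±1 ± i) ω` (independent signs) modulo `2ω` and `2iω`. -/
def polePoints : Set ℂ :=
  {p | ∃ a ∈ ({1, -1} : Set ℂ), ∃ b ∈ ({1, -1} : Set ℂ), ∃ m n : ℤ,
    p = 1 / 2 * (a + b * Complex.I) * omega + m * (2 * omega) + n * (2 * Complex.I * omega)}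

/-- The period lattice `L` has invariants `g₂ = 1` and `g₃ = 0`, so that its Weierstrass function
is the lemniscatic `℘`. -/
def IsLemniscatic (L : PeriodPair) : Prop := L.g₂ = 1 ∧ L.g₃ = 0

end Lemniscatic

/-! The engine is uniqueness for autonomous equations `y'' = g(y)`: two solutions with equal value
and derivative at a point agree near it, and the identity principle for meromorphic functions
spreads the agreement.

For `g₂ = 1`, `g₃ = 0` the function `1/℘` solves `y'' = 2 - (3/2)y²` with zero initial data at `0`.
Uniqueness yields `℘(iz) = -℘(z)` and that `℘` commutes with conjugation, so the lattice is stable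
under both maps. Its real points form `2aℤ` with `a > 0`. On `(0, a)` the real function `x = ℘`
falls from infinity to `1/2` along `x'² = 4x³ - x`; the substitution `v² = x - 1/(4x)` turns this
travel time into the arc length integral, giving `a = ω` (`eq_omega_of_ode`). The values `℘(ω) =
1/2` and `℘(iω) = -1/2` then decide which half-periods are periods (`lattice_eq`).

The function `p = sc` solves `p'' = -8p³`, `p(0) = 0`, `p'(0) = 1`, and so does `-½ ℘'/(℘² + ¼)`.
The extensions of `c²` and `s²` follow algebraically from `p' = c⁴ - s⁴`, `c⁴ + s⁴ = 1` and `p² =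
s²c²`.

For the poles, `4p²` and `1/℘(2z)` solve one and the same equation. The resulting duplication
formula shows that `℘² + ¼` vanishes exactly where `℘(2z)` does, that is, where `2z` is congruent to
`ω + iω`. The zeros of `℘² + ¼` are simple and none of the three numerators vanishes there. -/

namespace Lemniscatic

open Filter Topology

/-! ### Uniqueness for second order equations and the identity principle -/

/-- Two analytic functions that agree on a punctured neighbourhood agree on a neighbourhood. -/
theorem eventuallyEq_nhds_of_nhdsNE {f g : ℂ → ℂ} {a : ℂ} (hf : ContinuousAt f a)
    (hg : ContinuousAt g a) (h : f =ᶠ[𝓝[≠] a] g) : f =ᶠ[𝓝 a] g :=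
  (ContinuousAt.eventuallyEq_nhds_iff_eventuallyEq_nhdsNE hf hg).1 h

/-- Local uniqueness for the second order equation `y'' = g(y)`. -/
theorem eventuallyEq_of_deriv_deriv_eq {g y₁ y₂ : ℂ → ℂ} {a : ℂ} (hg : ContDiff ℂ 1 g)
    (h₁ : AnalyticAt ℂ y₁ a) (h₂ : AnalyticAt ℂ y₂ a)
    (e₁ : ∀ᶠ z in 𝓝[≠] a, deriv (deriv y₁) z = g (y₁ z))
    (e₂ : ∀ᶠ z in 𝓝[≠] a, deriv (deriv y₂) z = g (y₂ z))
    (h0 : y₁ a = y₂ a) (hd : deriv y₁ a = deriv y₂ a) : y₁ =ᶠ[𝓝 a] y₂ := by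
  have e₁' : ∀ᶠ z in 𝓝 a, deriv (deriv y₁) z = g (y₁ z) :=
    eventuallyEq_nhds_of_nhdsNE h₁.deriv.deriv.continuousAt
      (hg.continuous.continuousAt.comp h₁.continuousAt) e₁
  have e₂' : ∀ᶠ z in 𝓝 a, deriv (deriv y₂) z = g (y₂ z) :=
    eventuallyEq_nhds_of_nhdsNE h₂.deriv.deriv.continuousAt
      (hg.continuous.continuousAt.comp h₂.continuousAt) e₂
  obtain ⟨K, s, hs, hK⟩ := (hg.contDiffAt (x := y₁ a)).exists_lipschitzOnWith
  have hs₁ : ∀ᶠ z in 𝓝 a, y₁ z ∈ s := h₁.continuousAt hs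
  have hs₂ : ∀ᶠ z in 𝓝 a, y₂ z ∈ s := h₂.continuousAt (h0 ▸ hs)
  obtain ⟨r, hr, H⟩ := Metric.eventually_nhds_iff_ball.1
    (((h₁.eventually_analyticAt.and h₂.eventually_analyticAt).and (e₁'.and e₂')).and
      (hs₁.and hs₂))
  filter_upwards [Metric.ball_mem_nhds a hr] with z hz
  -- Restricting to the segment from `a` to `z` leaves a real-variable problem for the pair of
  -- differences, to which Grönwall's inequality applies.
  let γ : ℝ → ℂ := fun t => a + t * (z - a)
  have hγ : ∀ t : ℝ, HasDerivAt γ (z - a) t := fun t =>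
    (((Complex.ofRealCLM.hasDerivAt (x := t)).mul_const (z - a)).const_add a).congr_deriv
      (by simp)
  have hγm : ∀ t ∈ Set.Icc (0 : ℝ) 1, γ t ∈ Metric.ball a r := fun t ht => by
    simp only [γ, Metric.mem_ball, dist_eq_norm, add_sub_cancel_left, norm_mul,
      Complex.norm_real, Real.norm_of_nonneg ht.1] at hz ⊢
    exact (mul_le_of_le_one_left (norm_nonneg _) ht.2).trans_lt hz
  let F : ℝ → ℂ × ℂ := fun t =>
    (y₁ (γ t) - y₂ (γ t), deriv y₁ (γ t) - deriv y₂ (γ t))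
  let F' : ℝ → ℂ × ℂ := fun t =>
    ((deriv y₁ (γ t) - deriv y₂ (γ t)) * (z - a),
      (deriv (deriv y₁) (γ t) - deriv (deriv y₂) (γ t)) * (z - a))
  have hF : ∀ t ∈ Set.Icc (0 : ℝ) 1, HasDerivAt F (F' t) t := fun t ht => by
    obtain ⟨⟨⟨a₁, a₂⟩, -⟩, -⟩ := H _ (hγm t ht)
    refine HasDerivAt.prodMk ?_ ?_
    · exact (a₁.differentiableAt.hasDerivAt.sub a₂.differentiableAt.hasDerivAt).comp t (hγ t)
    · exact (a₁.deriv.differentiableAt.hasDerivAt.sub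
        a₂.deriv.differentiableAt.hasDerivAt).comp t (hγ t)
  have key := eq_zero_of_abs_deriv_le_mul_abs_self_of_eq_zero_right (f := F) (f' := F')
    (K := max 1 (K : ℝ) * ‖z - a‖) (a := 0) (b := 1)
    (fun t ht => (hF t ht).continuousAt.continuousWithinAt)
    (fun t ht => (hF t ⟨ht.1, ht.2.le⟩).hasDerivWithinAt)
    (by simp [F, γ, h0, hd]) ?_ 1 (by simp)
  · have := congrArg Prod.fst key
    simpa [F, γ, sub_eq_zero] using this
  · intro t ht
    obtain ⟨⟨-, o₁, o₂⟩, m₁, m₂⟩ := H _ (hγm t ⟨ht.1, ht.2.le⟩)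
    have hL : ‖g (y₁ (γ t)) - g (y₂ (γ t))‖ ≤ K * ‖y₁ (γ t) - y₂ (γ t)‖ := by
      simpa [dist_eq_norm] using hK.dist_le_mul _ m₁ _ m₂
    have n₁ : ‖y₁ (γ t) - y₂ (γ t)‖ ≤ ‖F t‖ := norm_fst_le (F t)
    have n₂ : ‖deriv y₁ (γ t) - deriv y₂ (γ t)‖ ≤ ‖F t‖ := norm_snd_le (F t)
    have hn := norm_nonneg (F t)
    refine norm_prod_le_iff.2 ⟨?_, ?_⟩
    · simp only [F', norm_mul]
      rw [mul_right_comm]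
      gcongr
      nlinarith [le_max_left 1 (K : ℝ)]
    · simp only [F', norm_mul, o₁, o₂]
      rw [mul_right_comm]
      gcongr
      exact hL.trans (mul_le_mul (le_max_right _ _) n₁ (norm_nonneg _) (by positivity))

/-- Identity principle for meromorphic functions on a preconnected set. -/
theorem eventuallyEq_nhdsNE_of_isPreconnected {f g : ℂ → ℂ} {U : Set ℂ} (hU : IsPreconnected U)
    (hf : MeromorphicOn f U) (hg : MeromorphicOn g U) {a z : ℂ} (ha : a ∈ U) (hz : z ∈ U)
    (h : f =ᶠ[𝓝[≠] a] g) : f =ᶠ[𝓝[≠] z] g := by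
  have hfg : MeromorphicOn (f - g) U := hf.sub hg
  have ht : meromorphicOrderAt (f - g) a = ⊤ :=
    meromorphicOrderAt_eq_top_iff.2 (h.mono fun x hx => by simp [hx])
  have : meromorphicOrderAt (f - g) z = ⊤ := by
    by_contra hne
    exact hfg.meromorphicOrderAt_ne_top_of_isPreconnected hU hz ha hne ht
  exact (meromorphicOrderAt_eq_top_iff.1 this).mono fun x hx => sub_eq_zero.1 hx

theorem eventuallyEq_nhdsNE_of_meromorphic {f g : ℂ → ℂ} (hf : Meromorphic f) (hg : Meromorphic g)
    {a : ℂ} (h : f =ᶠ[𝓝[≠] a] g) (z : ℂ) : f =ᶠ[𝓝[≠] z] g :=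
  eventuallyEq_nhdsNE_of_isPreconnected isPreconnected_univ
    (fun x _ => hf x) (fun x _ => hg x) (Set.mem_univ a) (Set.mem_univ z) h

/-- A function that is analytic at `0` is analytic at each of its periods. -/
theorem analyticAt_of_periodic {f : ℂ → ℂ} {l : ℂ} (hf : AnalyticAt ℂ f 0)
    (hl : Function.Periodic f l) : AnalyticAt ℂ f l := by
  have h : f = fun z => f (z - l) := by ext z; rw [hl.sub_eq]
  rw [h]
  have : AnalyticAt ℂ f (l - l) := by simpa using hf
  exact this.fun_comp (f := fun z => z - l) (by fun_prop)

section Affine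

variable {f : ℂ → ℂ} (b : ℂ) {c : ℂ}

theorem meromorphic_comp_affine (hf : Meromorphic f) (c : ℂ) :
    Meromorphic fun z => f (b + c * z) := fun z =>
  (hf (b + c * z)).comp_analyticAt (g := fun z => b + c * z) (by fun_prop)

theorem deriv_comp_affine (c : ℂ) :
    (deriv fun z => f (b + c * z)) = fun z => c * deriv f (b + c * z) := by
  ext z
  have := deriv_comp_mul_left c (fun z => f (b + z)) z
  rw [this, deriv_comp_const_add, smul_eq_mul]

theorem hasDerivAt_affine (c z : ℂ) : HasDerivAt (fun z => b + c * z) c z := by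
  simpa using ((hasDerivAt_id z).const_mul c).const_add b

theorem meromorphicOrderAt_comp_affine (hc : c ≠ 0) (z : ℂ) :
    meromorphicOrderAt (fun z => f (b + c * z)) z = meromorphicOrderAt f (b + c * z) :=
  meromorphicOrderAt_comp_of_deriv_ne_zero (f := f) (g := fun z => b + c * z) (by fun_prop)
    (by rwa [(hasDerivAt_affine b c z).deriv])

theorem tendsto_affine_nhdsNE (hc : c ≠ 0) (z : ℂ) :
    Tendsto (fun z => b + c * z) (𝓝[≠] z) (𝓝[≠] (b + c * z)) :=
  (hasDerivAt_affine b c z).tendsto_nhdsNE hc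

end Affine

/-! ### The Weierstrass function of a general lattice -/

variable (L : PeriodPair)

theorem meromorphicOrderAt_weierstrassP_neg_iff {z : ℂ} :
    meromorphicOrderAt L.weierstrassP z < 0 ↔ z ∈ L.lattice := by
  refine ⟨fun h => ?_, fun h => by rw [L.order_weierstrassP z h]; decide⟩
  by_contra hz
  exact absurd (L.analyticOnNhd_weierstrassP z hz).meromorphicOrderAt_nonneg (not_le.2 h)

theorem eventually_notMem_lattice (z : ℂ) : ∀ᶠ x in 𝓝[≠] z, x ∉ L.lattice := by
  filter_upwards [nhdsWithin_le_nhds (L.compl_lattice_sdiff_singleton_mem_nhds z),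
    self_mem_nhdsWithin] with x hx hxz hxL
  exact hx ⟨hxL, hxz⟩

theorem isOpen_compl_lattice : IsOpen (L.lattice : Set ℂ)ᶜ := L.isClosed_lattice.isOpen_compl

theorem hasDerivAt_weierstrassP {z : ℂ} (hz : z ∉ L.lattice) :
    HasDerivAt L.weierstrassP (L.derivWeierstrassP z) z := by
  rw [← L.deriv_weierstrassP]
  exact (L.analyticOnNhd_weierstrassP z hz).differentiableAt.hasDerivAt

theorem meromorphicOrderAt_derivWeierstrassP_zero :
    meromorphicOrderAt L.derivWeierstrassP 0 = ((-3 : ℤ) : WithTop ℤ) := by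
  rw [← L.deriv_weierstrassP]
  exact meromorphicOrderAt_deriv_eq_sub_one (n := -2) (by norm_num)
    (L.order_weierstrassP 0 (zero_mem _))

/-- Differentiating the cubic relation gives this after cancelling `2℘'`, which is nonzero near the
pole at `0`; the identity principle carries it to every regular point, including the zeros of `℘'`.
-/
theorem deriv_derivWeierstrassP {z : ℂ} (hz : z ∉ L.lattice) :
    deriv L.derivWeierstrassP z = 6 * L.weierstrassP z ^ 2 - L.g₂ / 2 := by
  have h0 : deriv L.derivWeierstrassP =ᶠ[𝓝[≠] 0]
      fun z => 6 * L.weierstrassP z ^ 2 - L.g₂ / 2 := by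
    filter_upwards [(meromorphicOrderAt_ne_top_iff_eventually_ne_zero
      (L.meromorphic_derivWeierstrassP 0)).1
        (by rw [meromorphicOrderAt_derivWeierstrassP_zero]; exact WithTop.coe_ne_top),
      eventually_notMem_lattice L 0] with z hz hzL
    have e : (fun z => L.derivWeierstrassP z ^ 2) =ᶠ[𝓝 z]
        fun z => 4 * L.weierstrassP z ^ 3 - L.g₂ * L.weierstrassP z - L.g₃ := by
      filter_upwards [(isOpen_compl_lattice L).mem_nhds hzL] with x hx
      exact L.derivWeierstrassP_sq x hx
    have d₁ := ((L.analyticOnNhd_derivWeierstrassP z hzL).differentiableAt.hasDerivAt.pow 2)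
    have hP := hasDerivAt_weierstrassP L hzL
    have d₂ := (((hP.pow 3).const_mul 4).sub (hP.const_mul L.g₂)).sub_const L.g₃
    have := (d₁.congr_of_eventuallyEq e.symm).unique d₂
    refine mul_left_cancel₀ (mul_ne_zero two_ne_zero hz) ?_
    push_cast at this
    linear_combination this
  have hm : Meromorphic fun z => 6 * L.weierstrassP z ^ 2 - L.g₂ / 2 := by
    have := L.meromorphic_weierstrassP
    fun_prop
  have h1 := eventuallyEq_nhdsNE_of_meromorphic
    (L.meromorphic_derivWeierstrassP).deriv hm h0 z
  exact (eventuallyEq_nhds_of_nhdsNE (L.analyticOnNhd_derivWeierstrassP z hz).deriv.continuousAt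
    ((L.analyticOnNhd_weierstrassP z hz).continuousAt.pow 2 |>.const_mul 6 |>.sub_const _)
    h1).self_of_nhds

theorem hasDerivAt_derivWeierstrassP {z : ℂ} (hz : z ∉ L.lattice) :
    HasDerivAt L.derivWeierstrassP (6 * L.weierstrassP z ^ 2 - L.g₂ / 2) z := by
  rw [← deriv_derivWeierstrassP L hz]
  exact (L.analyticOnNhd_derivWeierstrassP z hz).differentiableAt.hasDerivAt

theorem contDiff_quadratic (a b : ℂ) : ContDiff ℂ 1 fun y : ℂ => a * y ^ 2 + b := by fun_prop

theorem eventually_deriv_deriv_weierstrassP_affine {u c : ℂ} (hu : u ∉ L.lattice)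
    (hc : c ^ 2 = 1) :
    ∀ᶠ z in 𝓝 (0 : ℂ), deriv (deriv fun z => L.weierstrassP (u + c * z)) z
      = 6 * L.weierstrassP (u + c * z) ^ 2 + (- L.g₂ / 2) := by
  have ht : Tendsto (fun z => u + c * z) (𝓝 0) (𝓝 u) := by
    have : Continuous fun z => u + c * z := by fun_prop
    simpa using this.tendsto 0
  filter_upwards [ht ((isOpen_compl_lattice L).mem_nhds hu)] with z hz
  rw [deriv_comp_affine, L.deriv_weierstrassP]
  have := deriv_comp_affine (f := L.derivWeierstrassP) u c
  rw [deriv_const_mul_field, this]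
  simp only
  rw [deriv_derivWeierstrassP L hz]
  linear_combination (6 * L.weierstrassP (u + c * z) ^ 2 + (- L.g₂ / 2)) * hc

theorem analyticAt_weierstrassP_affine {u : ℂ} (hu : u ∉ L.lattice) (c : ℂ) :
    AnalyticAt ℂ (fun z => L.weierstrassP (u + c * z)) 0 :=
  (L.analyticOnNhd_weierstrassP (u + c * 0) (by simpa using hu)).fun_comp
    (f := fun z => u + c * z) (by fun_prop)

/-- Every zero of `℘'` is a half-period. -/
theorem add_self_mem_lattice_of_derivWeierstrassP_eq_zero {u : ℂ}
    (h : L.derivWeierstrassP u = 0) : u + u ∈ L.lattice := by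
  by_cases hu : u ∈ L.lattice
  · exact add_mem hu hu
  -- When `℘'(u) = 0`, the functions `℘(u + z)` and `℘(u - z)` have the same initial data. Comparing
  -- their orders at `z = u` then transports the pole at `0` to `2u`.
  have e : (fun z => L.weierstrassP (u + 1 * z)) =ᶠ[𝓝 0] fun z => L.weierstrassP (u + -1 * z) :=
    eventuallyEq_of_deriv_deriv_eq (contDiff_quadratic 6 (- L.g₂ / 2))
      (analyticAt_weierstrassP_affine L hu 1) (analyticAt_weierstrassP_affine L hu (-1))
      ((eventually_deriv_deriv_weierstrassP_affine L hu (by norm_num)).filter_mono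
        nhdsWithin_le_nhds)
      ((eventually_deriv_deriv_weierstrassP_affine L hu (by norm_num)).filter_mono
        nhdsWithin_le_nhds)
      (by simp) (by rw [deriv_comp_affine, deriv_comp_affine]; simp [h])
  have e' := eventuallyEq_nhdsNE_of_meromorphic
    (meromorphic_comp_affine u L.meromorphic_weierstrassP 1)
    (meromorphic_comp_affine u L.meromorphic_weierstrassP (-1))
    (e.filter_mono nhdsWithin_le_nhds) u
  have ho := meromorphicOrderAt_congr e'
  rw [meromorphicOrderAt_comp_affine _ one_ne_zero,
    meromorphicOrderAt_comp_affine _ (neg_ne_zero.2 one_ne_zero)] at ho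
  rw [one_mul] at ho
  rw [← meromorphicOrderAt_weierstrassP_neg_iff, ho, meromorphicOrderAt_weierstrassP_neg_iff]
  simp

/-- At a point off the lattice, `℘` does not vanish together with `℘'` when `g₂ = 0`. -/
theorem derivWeierstrassP_ne_zero_of_g₂_eq_zero (hg : L.g₂ = 0) {u : ℂ} (hu : u ∉ L.lattice)
    (h0 : L.weierstrassP u = 0) : L.derivWeierstrassP u ≠ 0 := by
  intro h
  have e : (fun z => L.weierstrassP (u + 1 * z)) =ᶠ[𝓝 0] fun _ => 0 :=
    eventuallyEq_of_deriv_deriv_eq (contDiff_quadratic 6 (- L.g₂ / 2))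
      (analyticAt_weierstrassP_affine L hu 1) analyticAt_const
      ((eventually_deriv_deriv_weierstrassP_affine L hu (by norm_num)).filter_mono
        nhdsWithin_le_nhds) (by simp [hg])
      (by simp [h0]) (by rw [deriv_comp_affine]; simp [h])
  -- At `z = -u` the zero function would have to reproduce the pole of `℘` at the origin.
  have e' := eventuallyEq_nhdsNE_of_meromorphic
    (meromorphic_comp_affine u L.meromorphic_weierstrassP 1) (by fun_prop)
    (e.filter_mono nhdsWithin_le_nhds) (-u)
  have ho := meromorphicOrderAt_eq_top_iff.2 e'
  rw [meromorphicOrderAt_comp_affine _ one_ne_zero, L.order_weierstrassP _ (by simp)] at ho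
  exact absurd ho (by decide)

theorem meromorphicOrderAt_inv_weierstrassP_zero :
    meromorphicOrderAt (fun z => (L.weierstrassP z)⁻¹) 0 = ((2 : ℤ) : WithTop ℤ) := by
  rw [fun_meromorphicOrderAt_inv, L.order_weierstrassP 0 (zero_mem _)]
  rfl

theorem analyticAt_inv_weierstrassP_zero : AnalyticAt ℂ (fun z => (L.weierstrassP z)⁻¹) 0 :=
  .of_meromorphicOrderAt_pos (by rw [meromorphicOrderAt_inv_weierstrassP_zero]; decide) (by simp)

theorem deriv_inv_weierstrassP_zero : deriv (fun z => (L.weierstrassP z)⁻¹) 0 = 0 := by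
  have h := meromorphicOrderAt_deriv_eq_sub_one (n := 2) (by norm_num)
    (meromorphicOrderAt_inv_weierstrassP_zero L)
  exact tendsto_nhds_unique
    ((analyticAt_inv_weierstrassP_zero L).deriv.continuousAt.tendsto.mono_left nhdsWithin_le_nhds)
    (tendsto_zero_of_meromorphicOrderAt_pos (by rw [h]; decide))

theorem eventually_weierstrassP_ne_zero : ∀ᶠ z in 𝓝[≠] 0, L.weierstrassP z ≠ 0 :=
  (meromorphicOrderAt_ne_top_iff_eventually_ne_zero (L.meromorphic_weierstrassP 0)).1
    (by rw [L.order_weierstrassP 0 (zero_mem _)]; decide)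

/-! ### Existence of a lemniscatic lattice -/

/-- The period pair `(l, l i)` of a square lattice. -/
noncomputable def squarePair (l : ℂ) (hl : l ≠ 0) : PeriodPair where
  ω₁ := l
  ω₂ := l * Complex.I
  indep := by
    refine LinearIndependent.pair_iff.2 fun s t h => ?_
    have : l * (s + t * Complex.I) = 0 := by
      rw [Complex.real_smul, Complex.real_smul] at h
      linear_combination h
    have h' := (mul_eq_zero.1 this).resolve_left hl
    simpa using And.intro (congrArg Complex.re h') (congrArg Complex.im h')

theorem G_eq_tsum (L : PeriodPair) (k : ℕ) :
    L.G k = ∑' x : ℤ × ℤ, ((x.1 * L.ω₁ + x.2 * L.ω₂) ^ k)⁻¹ := by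
  rw [PeriodPair.G, ← L.latticeEquivProd.symm.toEquiv.tsum_eq]
  exact tsum_congr fun x => by
    rw [← L.latticeEquiv_symm_apply]; rfl

theorem G_squarePair (l : ℂ) (hl : l ≠ 0) (k : ℕ) :
    (squarePair l hl).G k = (l ^ k)⁻¹ * (squarePair 1 one_ne_zero).G k := by
  rw [G_eq_tsum, G_eq_tsum, ← tsum_mul_left]
  refine tsum_congr fun x => ?_
  simp only [squarePair]
  rw [← mul_inv, ← mul_pow]
  ring_nf

/-- Multiplication by `i` permutes the Gaussian integers, and `i⁶ = -1`, so the sum equals its own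
negative. -/
theorem G_six_squarePair_one : (squarePair 1 one_ne_zero).G 6 = 0 := by
  rw [← CharZero.eq_neg_self_iff, G_eq_tsum, ← tsum_neg]
  let e : ℤ × ℤ ≃ ℤ × ℤ :=
    ⟨fun x => (-x.2, x.1), fun x => (x.2, -x.1), fun x => by simp, fun x => by simp⟩
  rw [← e.tsum_eq]
  refine tsum_congr fun x => ?_
  simp only [squarePair, e, Equiv.coe_fn_mk]
  rw [← inv_neg]
  congr 1
  have h : ((-x.2 : ℤ) : ℂ) * 1 + (x.1 : ℂ) * (1 * Complex.I)
      = Complex.I * (x.1 * 1 + x.2 * (1 * Complex.I)) := by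
    push_cast
    linear_combination (-(x.2 : ℂ)) * Complex.I_sq
  rw [h, mul_pow, show (6 : ℕ) = 4 + 2 from rfl, pow_add Complex.I, Complex.I_pow_four,
    Complex.I_sq]
  ring

/-- Here `u` and `-u` are congruent, while `℘'` is odd. -/
theorem derivWeierstrassP_eq_zero_of_add_self_mem (L : PeriodPair) {u : ℂ}
    (hu : u + u ∈ L.lattice) : L.derivWeierstrassP u = 0 := by
  have h := L.derivWeierstrassP_sub_coe u ⟨u + u, hu⟩
  rw [show u - (u + u) = -u by ring, L.derivWeierstrassP_neg] at h
  exact CharZero.eq_neg_self_iff.1 h.symm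

/-- If both invariants vanished, `℘'² = 4℘³` would make `℘` and `℘'` vanish together at a
half-period. -/
theorem g₂_squarePair_one_ne_zero : (squarePair 1 one_ne_zero).g₂ ≠ 0 := by
  intro hg
  set L := squarePair 1 one_ne_zero
  have hu := L.ω₁_div_two_notMem_lattice
  have hd : L.derivWeierstrassP (L.ω₁ / 2) = 0 :=
    derivWeierstrassP_eq_zero_of_add_self_mem L (by rw [add_halves]; exact L.ω₁_mem_lattice)
  have h3 : L.g₃ = 0 := by rw [PeriodPair.g₃, G_six_squarePair_one, mul_zero]
  have hsq := L.derivWeierstrassP_sq _ hu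
  rw [hd, hg, h3] at hsq
  refine derivWeierstrassP_ne_zero_of_g₂_eq_zero L hg hu ?_ hd
  simpa using hsq.symm

theorem exists_isLemniscatic : ∃ L : PeriodPair, IsLemniscatic L := by
  -- Scaling the lattice by `l` divides `g₂` by `l⁴`, so a fourth root of `g₂` normalises it to `1`.
  obtain ⟨l, hl⟩ := IsAlgClosed.exists_pow_nat_eq (squarePair 1 one_ne_zero).g₂
    (show 0 < 4 by norm_num)
  have hg := g₂_squarePair_one_ne_zero
  have hl0 : l ≠ 0 := by
    rintro rfl
    exact hg (by simpa using hl.symm)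
  refine ⟨squarePair l hl0, ?_, ?_⟩
  · rw [PeriodPair.g₂, G_squarePair, hl]
    rw [PeriodPair.g₂] at hg ⊢
    field_simp
    exact div_self (right_ne_zero_of_mul hg)
  · rw [PeriodPair.g₃, G_squarePair, G_six_squarePair_one, mul_zero, mul_zero]

/-! ### Candidates for the three extensions -/

/-- The candidate `-½ ℘' / (℘² + ¼)` for the extension of `sc`. -/
noncomputable def scExt (L : PeriodPair) (z : ℂ) : ℂ :=
  -(1 / 2) * (L.derivWeierstrassP z / (L.weierstrassP z ^ 2 + 1 / 4))

/-- The candidate `℘ / (℘² + ¼)` for the extension of `s²`. -/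
noncomputable def sqSExt (L : PeriodPair) (z : ℂ) : ℂ :=
  L.weierstrassP z / (L.weierstrassP z ^ 2 + 1 / 4)

open Classical in
/-- The candidate `(℘² - ¼) / (℘² + ¼)` for the extension of `c²`, with its value `1` at the
removable singularities. -/
noncomputable def sqCExt (L : PeriodPair) (z : ℂ) : ℂ :=
  if z ∈ L.lattice then 1 else (L.weierstrassP z ^ 2 - 1 / 4) / (L.weierstrassP z ^ 2 + 1 / 4)

theorem meromorphic_scExt (L : PeriodPair) : Meromorphic (scExt L) := by
  have h₁ := L.meromorphic_weierstrassP
  have h₂ := L.meromorphic_derivWeierstrassP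
  unfold scExt
  fun_prop

/-- This turns a functional symmetry of `℘` into a symmetry of the lattice: an image of a period off
the lattice would make `℘` agree with a continuous function near a pole. -/
theorem not_continuousAt_of_eventuallyEq {L : PeriodPair} {f : ℂ → ℂ} {l : ℂ} (hl : l ∈ L.lattice)
    (h : L.weierstrassP =ᶠ[𝓝[≠] l] f) : ¬ ContinuousAt f l := fun hf => by
  have h₁ := (tendsto_nhds_iff_meromorphicOrderAt_nonneg (L.meromorphic_weierstrassP l)).1
    ⟨f l, (hf.tendsto.mono_left nhdsWithin_le_nhds).congr' h.symm⟩
  exact absurd h₁ (not_le.2 ((meromorphicOrderAt_weierstrassP_neg_iff L).2 hl))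

theorem analyticAt_conj_conj {f : ℂ → ℂ} {x : ℂ} (hf : AnalyticAt ℂ f (starRingEnd ℂ x)) :
    AnalyticAt ℂ (starRingEnd ℂ ∘ f ∘ starRingEnd ℂ) x := by
  rw [Complex.analyticAt_iff_eventually_differentiableAt] at hf ⊢
  have := (Complex.continuous_conj.tendsto x).eventually hf
  filter_upwards [this] with z hz
  simpa using hz.conj_conj

theorem meromorphic_conj_conj {f : ℂ → ℂ} (hf : Meromorphic f) :
    Meromorphic (starRingEnd ℂ ∘ f ∘ starRingEnd ℂ) := fun x => by
  obtain ⟨n, hn⟩ := hf (starRingEnd ℂ x)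
  refine ⟨n, ?_⟩
  convert! analyticAt_conj_conj hn using 2 with z
  simp

/-! ### Symmetries of the lemniscatic function -/

namespace IsLemniscatic

variable {L : PeriodPair} (hL : IsLemniscatic L)

include hL

theorem derivWeierstrassP_sq {z : ℂ} (hz : z ∉ L.lattice) :
    L.derivWeierstrassP z ^ 2 = 4 * L.weierstrassP z ^ 3 - L.weierstrassP z := by
  rw [L.derivWeierstrassP_sq z hz, hL.1, hL.2]; ring

theorem hasDerivAt_derivWeierstrassP {z : ℂ} (hz : z ∉ L.lattice) :
    HasDerivAt L.derivWeierstrassP (6 * L.weierstrassP z ^ 2 - 1 / 2) z := by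
  simpa [hL.1] using Lemniscatic.hasDerivAt_derivWeierstrassP L hz

theorem eventually_deriv_deriv_inv_weierstrassP :
    ∀ᶠ z in 𝓝[≠] 0, deriv (deriv fun z => (L.weierstrassP z)⁻¹) z
      = -(3 / 2) * ((L.weierstrassP z)⁻¹) ^ 2 + 2 := by
  filter_upwards [eventually_weierstrassP_ne_zero L, eventually_notMem_lattice L 0] with z hz hzL
  have hP := hasDerivAt_weierstrassP L hzL
  have e : deriv (fun z => (L.weierstrassP z)⁻¹) =ᶠ[𝓝 z]
      fun z => -L.derivWeierstrassP z / L.weierstrassP z ^ 2 := by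
    filter_upwards [hP.continuousAt.eventually_ne hz, (isOpen_compl_lattice L).mem_nhds hzL]
      with x hx hxL
    exact ((hasDerivAt_weierstrassP L hxL).fun_inv hx).deriv
  rw [e.deriv_eq,
    ((hL.hasDerivAt_derivWeierstrassP hzL).fun_neg.fun_div (hP.fun_pow 2) (pow_ne_zero 2 hz)).deriv]
  have := hL.derivWeierstrassP_sq hzL
  field_simp
  push_cast
  linear_combination (4 * L.weierstrassP z) * this

/-- The reciprocal of the lemniscatic `℘` is determined by its differential equation. -/
theorem eventuallyEq_inv_weierstrassP {y : ℂ → ℂ} (hy : AnalyticAt ℂ y 0) (h0 : y 0 = 0)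
    (h1 : deriv y 0 = 0)
    (h2 : ∀ᶠ z in 𝓝[≠] 0, deriv (deriv y) z = -(3 / 2) * y z ^ 2 + 2) :
    y =ᶠ[𝓝 0] fun z => (L.weierstrassP z)⁻¹ :=
  eventuallyEq_of_deriv_deriv_eq (contDiff_quadratic (-(3 / 2)) 2) hy
    (analyticAt_inv_weierstrassP_zero L) h2 hL.eventually_deriv_deriv_inv_weierstrassP
    (by simp [h0]) (by rw [h1, deriv_inv_weierstrassP_zero])

/-- The function `y(z) = -1/℘(iz)` solves the equation of `1/℘`: the factor `i² = -1` from two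
derivatives cancels the outer sign, and the right-hand side is even in `y`. -/
theorem weierstrassP_I_mul_eventuallyEq (z : ℂ) :
    L.weierstrassP =ᶠ[𝓝[≠] z] fun x => -L.weierstrassP (0 + Complex.I * x) := by
  refine eventuallyEq_nhdsNE_of_meromorphic (a := 0) L.meromorphic_weierstrassP
    (meromorphic_comp_affine 0 L.meromorphic_weierstrassP Complex.I).fun_neg ?_ z
  have hI := tendsto_affine_nhdsNE 0 Complex.I_ne_zero 0
  rw [mul_zero, add_zero] at hI
  have hd := deriv_comp_affine (f := fun z => (L.weierstrassP z)⁻¹) 0 Complex.I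
  have key := hL.eventuallyEq_inv_weierstrassP
    (y := fun z => -(L.weierstrassP (0 + Complex.I * z))⁻¹) ?_ (by simp) ?_ ?_
  · filter_upwards [key.filter_mono nhdsWithin_le_nhds] with x hx
    rw [← inv_inj, ← hx, inv_neg]
  · exact (AnalyticAt.fun_comp (g := fun z => (L.weierstrassP z)⁻¹)
      (f := fun z => 0 + Complex.I * z)
      (by simpa using analyticAt_inv_weierstrassP_zero L) (by fun_prop)).fun_neg
  · rw [deriv.fun_neg, hd]
    simp [deriv_inv_weierstrassP_zero]
  · filter_upwards [hI.eventually hL.eventually_deriv_deriv_inv_weierstrassP] with x hx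
    rw [deriv.fun_neg', hd, deriv.fun_neg, deriv_const_mul_field,
      deriv_comp_affine (f := deriv fun z => (L.weierstrassP z)⁻¹)]
    simp only
    rw [hx, ← mul_assoc, Complex.I_mul_I]
    ring

/-- The equation of `1/℘` has real coefficients, so conjugating on both sides preserves it and its
zero initial data. -/
theorem weierstrassP_conj_eventuallyEq (z : ℂ) :
    L.weierstrassP =ᶠ[𝓝[≠] z] starRingEnd ℂ ∘ L.weierstrassP ∘ starRingEnd ℂ := by
  refine eventuallyEq_nhdsNE_of_meromorphic (a := 0) L.meromorphic_weierstrassP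
    (meromorphic_conj_conj L.meromorphic_weierstrassP) ?_ z
  have hc : Tendsto (starRingEnd ℂ) (𝓝[≠] 0) (𝓝[≠] 0) := by
    refine tendsto_nhdsWithin_of_tendsto_nhds_of_eventually_within _
      ((Complex.continuous_conj.tendsto' 0 0 (by simp)).mono_left nhdsWithin_le_nhds) ?_
    filter_upwards [self_mem_nhdsWithin] with x hx
    simpa using hx
  have key := hL.eventuallyEq_inv_weierstrassP
    (y := starRingEnd ℂ ∘ (fun z => (L.weierstrassP z)⁻¹) ∘ starRingEnd ℂ) ?_ (by simp) ?_ ?_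
  · filter_upwards [key.filter_mono nhdsWithin_le_nhds] with x hx
    rw [← inv_inj, ← hx]
    simp
  · exact analyticAt_conj_conj (by simpa using analyticAt_inv_weierstrassP_zero L)
  · rw [deriv_conj_conj]
    simp [deriv_inv_weierstrassP_zero]
  · filter_upwards [hc.eventually hL.eventually_deriv_deriv_inv_weierstrassP] with x hx
    rw [deriv_conj_conj, deriv_conj_conj]
    simp only [Function.comp_apply, hx]
    simp [map_ofNat]

theorem I_mul_mem_lattice {l : ℂ} (hl : l ∈ L.lattice) : Complex.I * l ∈ L.lattice := by
  by_contra h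
  refine not_continuousAt_of_eventuallyEq hl (hL.weierstrassP_I_mul_eventuallyEq l)
    (ContinuousAt.fun_neg ?_)
  exact ContinuousAt.comp' (g := L.weierstrassP) (f := fun x => 0 + Complex.I * x)
    (L.analyticOnNhd_weierstrassP _ (by simpa using h)).continuousAt (by fun_prop)

theorem conj_mem_lattice {l : ℂ} (hl : l ∈ L.lattice) : starRingEnd ℂ l ∈ L.lattice := by
  by_contra h
  refine not_continuousAt_of_eventuallyEq hl (hL.weierstrassP_conj_eventuallyEq l) ?_
  exact Complex.continuous_conj.continuousAt.comp (ContinuousAt.comp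
    (L.analyticOnNhd_weierstrassP _ h).continuousAt Complex.continuous_conj.continuousAt)

theorem weierstrassP_I_mul (z : ℂ) : L.weierstrassP (Complex.I * z) = -L.weierstrassP z := by
  by_cases hz : z ∈ L.lattice
  · rw [L.weierstrassP_coe ⟨z, hz⟩, L.weierstrassP_coe ⟨_, hL.I_mul_mem_lattice hz⟩, neg_zero]
  have hz' : Complex.I * z ∉ L.lattice := fun h => hz <| by
    have := L.lattice.neg_mem (hL.I_mul_mem_lattice h)
    rwa [← mul_assoc, Complex.I_mul_I, neg_one_mul, neg_neg] at this
  have := (eventuallyEq_nhds_of_nhdsNE (L.analyticOnNhd_weierstrassP z hz).continuousAt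
    (ContinuousAt.fun_neg (ContinuousAt.comp' (g := L.weierstrassP)
      (f := fun x => 0 + Complex.I * x)
      (L.analyticOnNhd_weierstrassP _ (by simpa using hz')).continuousAt (by fun_prop)))
    (hL.weierstrassP_I_mul_eventuallyEq z)).self_of_nhds
  simp [this]

theorem weierstrassP_conj (z : ℂ) :
    L.weierstrassP (starRingEnd ℂ z) = starRingEnd ℂ (L.weierstrassP z) := by
  by_cases hz : z ∈ L.lattice
  · rw [L.weierstrassP_coe ⟨z, hz⟩, L.weierstrassP_coe ⟨_, hL.conj_mem_lattice hz⟩, map_zero]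
  have hz' : starRingEnd ℂ z ∉ L.lattice := fun h => hz <| by
    simpa using hL.conj_mem_lattice h
  have := (eventuallyEq_nhds_of_nhdsNE (L.analyticOnNhd_weierstrassP z hz).continuousAt
    (Complex.continuous_conj.continuousAt.comp (ContinuousAt.comp
      (L.analyticOnNhd_weierstrassP _ hz').continuousAt Complex.continuous_conj.continuousAt))
    (hL.weierstrassP_conj_eventuallyEq z)).self_of_nhds
  rw [this]
  simp

/-! ### Differential equations of the candidates -/

section

variable {z : ℂ} (hz : z ∉ L.lattice) (hD : L.weierstrassP z ^ 2 + 1 / 4 ≠ 0)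
include hz hD

omit hL in
theorem eventually_regular : ∀ᶠ x in 𝓝 z, x ∉ L.lattice ∧ L.weierstrassP x ^ 2 + 1 / 4 ≠ 0 := by
  have := ((L.analyticOnNhd_weierstrassP z hz).continuousAt.pow 2).add_const (1 / 4)
  exact Filter.Eventually.and ((isOpen_compl_lattice L).mem_nhds hz) (this.eventually_ne hD)

/-- This and the next two derivatives copy the system satisfied by `sc`, `s²` and `c²`: `(sc)' = c⁴
- s⁴`, `(s²)' = 2(sc)c²`, `(c²)' = -2(sc)s²`. -/
theorem hasDerivAt_scExt : HasDerivAt (scExt L) (sqCExt L z ^ 2 - sqSExt L z ^ 2) z := by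
  refine (((hL.hasDerivAt_derivWeierstrassP hz).fun_div
    (((hasDerivAt_weierstrassP L hz).fun_pow 2).add_const (1 / 4)) hD).const_mul
    (-(1 / 2) : ℂ)).congr_deriv ?_
  have := hL.derivWeierstrassP_sq hz
  simp only [sqCExt, sqSExt, if_neg hz]
  rw [div_pow, div_pow, ← sub_div, ← mul_div_assoc]
  congr 1
  push_cast
  linear_combination L.weierstrassP z * this

omit hL in
theorem hasDerivAt_sqSExt : HasDerivAt (sqSExt L) (2 * (scExt L z * sqCExt L z)) z := by
  refine ((hasDerivAt_weierstrassP L hz).fun_div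
    (((hasDerivAt_weierstrassP L hz).fun_pow 2).add_const (1 / 4)) hD).congr_deriv ?_
  simp only [sqCExt, scExt, if_neg hz]
  field_simp
  push_cast
  ring

omit hL in
theorem hasDerivAt_sqCExt : HasDerivAt (sqCExt L) (-2 * (scExt L z * sqSExt L z)) z := by
  have h := ((((hasDerivAt_weierstrassP L hz).fun_pow 2).sub_const (1 / 4)).fun_div
    (((hasDerivAt_weierstrassP L hz).fun_pow 2).add_const (1 / 4)) hD)
  refine (h.congr_of_eventuallyEq ?_).congr_deriv ?_
  · filter_upwards [(isOpen_compl_lattice L).mem_nhds hz] with x hx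
    exact if_neg hx
  simp only [sqSExt, scExt]
  field_simp
  push_cast
  ring

omit hD in
theorem scExt_sq : scExt L z ^ 2 = sqSExt L z * sqCExt L z := by
  have := hL.derivWeierstrassP_sq hz
  simp only [sqSExt, scExt, sqCExt, if_neg hz]
  rw [mul_pow, div_pow, this]
  field_simp
  ring

theorem deriv_deriv_scExt : deriv (deriv (scExt L)) z = -8 * scExt L z ^ 3 := by
  have e : deriv (scExt L) =ᶠ[𝓝 z] fun z => sqCExt L z ^ 2 - sqSExt L z ^ 2 := by
    filter_upwards [eventually_regular hz hD] with x hx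
    exact (hL.hasDerivAt_scExt hx.1 hx.2).deriv
  rw [e.deriv_eq, (((hasDerivAt_sqCExt hz hD).fun_pow 2).fun_sub
    ((hasDerivAt_sqSExt hz hD).fun_pow 2)).deriv]
  push_cast
  linear_combination (8 * scExt L z) * (hL.scExt_sq hz)

end

end IsLemniscatic

/-! ### Behaviour at the origin and the duplication formula -/

namespace IsLemniscatic

variable {L : PeriodPair}

theorem analyticAt_inv_weierstrassP_sq_div :
    AnalyticAt ℂ (fun z => ((L.weierstrassP z)⁻¹) ^ 2 / 4) 0 :=
  ((analyticAt_inv_weierstrassP_zero L).fun_pow 2).fun_div analyticAt_const (by norm_num)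

theorem eventually_one_add_ne_zero :
    ∀ᶠ z in 𝓝 0, 1 + ((L.weierstrassP z)⁻¹) ^ 2 / 4 ≠ 0 := by
  have h : ContinuousAt (fun z => 1 + ((L.weierstrassP z)⁻¹) ^ 2 / 4) 0 :=
    (((analyticAt_inv_weierstrassP_zero L).continuousAt.pow 2).div_const 4).const_add 1
  exact h.eventually_ne (by simp)

theorem eventually_regular_zero :
    ∀ᶠ z in 𝓝[≠] 0, z ∉ L.lattice ∧ L.weierstrassP z ≠ 0 ∧ L.weierstrassP z ^ 2 + 1 / 4 ≠ 0 := by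
  filter_upwards [eventually_weierstrassP_ne_zero L, eventually_notMem_lattice L 0,
    (eventually_one_add_ne_zero (L := L)).filter_mono nhdsWithin_le_nhds] with z h0 hz h1
  refine ⟨hz, h0, fun h => h1 ?_⟩
  field_simp
  linear_combination 4 * h

/-- Rewriting in terms of `1/℘` exhibits analyticity at `0`. The equality includes the point `0`
itself, because the conventional value of `℘` there is `0`. -/
theorem sqSExt_eventuallyEq : sqSExt L =ᶠ[𝓝 0]
    fun z => (L.weierstrassP z)⁻¹ / (1 + ((L.weierstrassP z)⁻¹) ^ 2 / 4) := by
  refine eventuallyEq_nhds_of_eventuallyEq_nhdsNE ?_ (by simp [sqSExt])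
  filter_upwards [eventually_regular_zero (L := L)] with z hz
  obtain ⟨-, h0, h1⟩ := hz
  have h1' : 4 * L.weierstrassP z ^ 2 + 1 ≠ 0 := fun h => h1 (by linear_combination h / 4)
  rw [sqSExt]
  field_simp

theorem sqCExt_eventuallyEq : sqCExt L =ᶠ[𝓝 0] fun z =>
    (1 - ((L.weierstrassP z)⁻¹) ^ 2 / 4) / (1 + ((L.weierstrassP z)⁻¹) ^ 2 / 4) := by
  refine eventuallyEq_nhds_of_eventuallyEq_nhdsNE ?_ (by simp [sqCExt])
  filter_upwards [eventually_regular_zero (L := L)] with z hz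
  obtain ⟨hL, h0, h1⟩ := hz
  have h1' : 4 * L.weierstrassP z ^ 2 + 1 ≠ 0 := fun h => h1 (by linear_combination h / 4)
  rw [sqCExt, if_neg hL]
  field_simp

theorem scExt_eventuallyEq : scExt L =ᶠ[𝓝 0] fun z =>
    (1 / 2) * deriv (fun z => (L.weierstrassP z)⁻¹) z / (1 + ((L.weierstrassP z)⁻¹) ^ 2 / 4) := by
  refine eventuallyEq_nhds_of_eventuallyEq_nhdsNE ?_
    (by simp [scExt, deriv_inv_weierstrassP_zero])
  filter_upwards [eventually_regular_zero (L := L)] with z hz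
  obtain ⟨hL, h0, h1⟩ := hz
  have h1' : 4 * L.weierstrassP z ^ 2 + 1 ≠ 0 := fun h => h1 (by linear_combination h / 4)
  rw [scExt, ((hasDerivAt_weierstrassP L hL).fun_inv h0).deriv]
  field_simp

theorem analyticAt_sqSExt_zero : AnalyticAt ℂ (sqSExt L) 0 := by
  have h := analyticAt_inv_weierstrassP_zero L
  exact (h.fun_div (analyticAt_const.add analyticAt_inv_weierstrassP_sq_div)
    eventually_one_add_ne_zero.self_of_nhds).congr sqSExt_eventuallyEq.symm

theorem analyticAt_sqCExt_zero : AnalyticAt ℂ (sqCExt L) 0 := by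
  have h := analyticAt_inv_weierstrassP_zero L
  exact ((analyticAt_const.sub analyticAt_inv_weierstrassP_sq_div).fun_div
    (analyticAt_const.add analyticAt_inv_weierstrassP_sq_div)
    eventually_one_add_ne_zero.self_of_nhds).congr sqCExt_eventuallyEq.symm

theorem analyticAt_scExt_zero : AnalyticAt ℂ (scExt L) 0 := by
  have h := analyticAt_inv_weierstrassP_zero L
  exact ((analyticAt_const.mul h.deriv).fun_div
    (analyticAt_const.add analyticAt_inv_weierstrassP_sq_div)
    eventually_one_add_ne_zero.self_of_nhds).congr scExt_eventuallyEq.symm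

@[simp] theorem scExt_zero : scExt L 0 = 0 := by simp [scExt]

@[simp] theorem sqSExt_zero : sqSExt L 0 = 0 := by simp [sqSExt]

@[simp] theorem sqCExt_zero : sqCExt L 0 = 1 := by simp [sqCExt]

theorem sqSExt_sq_add_sqCExt_sq {z : ℂ} (hz : z ∉ L.lattice)
    (hD : L.weierstrassP z ^ 2 + 1 / 4 ≠ 0) : sqSExt L z ^ 2 + sqCExt L z ^ 2 = 1 := by
  rw [sqSExt, sqCExt, if_neg hz, div_pow, div_pow, ← add_div, div_eq_one_iff_eq (pow_ne_zero 2 hD)]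
  ring

variable (hL : IsLemniscatic L)
include hL

theorem deriv_scExt_eventuallyEq :
    deriv (scExt L) =ᶠ[𝓝 0] fun z => sqCExt L z ^ 2 - sqSExt L z ^ 2 := by
  refine eventuallyEq_nhds_of_nhdsNE analyticAt_scExt_zero.deriv.continuousAt
    ((analyticAt_sqCExt_zero.continuousAt.pow 2).sub (analyticAt_sqSExt_zero.continuousAt.pow 2)) ?_
  filter_upwards [eventually_regular_zero (L := L)] with z hz
  exact (hL.hasDerivAt_scExt hz.1 hz.2.2).deriv

theorem deriv_scExt_zero : deriv (scExt L) 0 = 1 := by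
  rw [hL.deriv_scExt_eventuallyEq.self_of_nhds]
  simp

/-- Both sides solve `y'' = 8 - 6y²` with `y(0) = y'(0) = 0`. -/
theorem inv_weierstrassP_two_mul_eventuallyEq :
    (fun z => 4 * scExt L z ^ 2) =ᶠ[𝓝 0] fun z => (L.weierstrassP (0 + 2 * z))⁻¹ := by
  have hp := analyticAt_scExt_zero (L := L)
  have h2 := tendsto_affine_nhdsNE 0 (two_ne_zero (α := ℂ)) 0
  rw [mul_zero, add_zero] at h2
  have hd := deriv_comp_affine (f := fun z => (L.weierstrassP z)⁻¹) 0 2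
  have hdp : deriv (fun z => 4 * scExt L z ^ 2) =ᶠ[𝓝 0]
      fun z => 8 * scExt L z * deriv (scExt L) z := by
    filter_upwards [hp.eventually_analyticAt] with z hz
    rw [((hz.differentiableAt.hasDerivAt.fun_pow 2).const_mul 4).deriv]
    push_cast
    ring
  refine eventuallyEq_of_deriv_deriv_eq (contDiff_quadratic (-6) 8)
    (analyticAt_const.mul (hp.pow 2)) ?_ ?_ ?_ (by simp) ?_
  · exact (AnalyticAt.fun_comp (g := fun z => (L.weierstrassP z)⁻¹)
      (f := fun z => 0 + 2 * z)
      (by simpa using analyticAt_inv_weierstrassP_zero L) (by fun_prop))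
  · filter_upwards [eventually_regular_zero (L := L),
      hdp.eventuallyEq_nhds.filter_mono nhdsWithin_le_nhds] with z hz hzd
    have h₁ := hL.hasDerivAt_scExt hz.1 hz.2.2
    have h₂ : HasDerivAt (deriv (scExt L)) (-8 * scExt L z ^ 3) z := by
      rw [← hL.deriv_deriv_scExt hz.1 hz.2.2]
      refine DifferentiableAt.hasDerivAt (AnalyticAt.differentiableAt ?_)
      refine AnalyticAt.deriv ((Complex.analyticAt_iff_eventually_differentiableAt).2 ?_)
      filter_upwards [eventually_regular hz.1 hz.2.2] with x hx
      exact (hL.hasDerivAt_scExt hx.1 hx.2).differentiableAt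
    rw [hzd.deriv_eq, ((h₁.const_mul 8).fun_mul h₂).deriv, h₁.deriv]
    have e₁ := sqSExt_sq_add_sqCExt_sq hz.1 hz.2.2
    have e₂ := hL.scExt_sq hz.1
    -- With `p`, `S`, `C` for the candidates, `p'² = (C² - S²)² = 1 - 4p⁴`, by `S² + C² = 1` and `p²
    -- = SC`.
    linear_combination (8 * (sqSExt L z ^ 2 + sqCExt L z ^ 2 + 1)) * e₁
      - 32 * (scExt L z ^ 2 - sqSExt L z * sqCExt L z + 2 * sqSExt L z * sqCExt L z) * -e₂
  · filter_upwards [h2.eventually hL.eventually_deriv_deriv_inv_weierstrassP] with x hx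
    rw [hd, deriv_const_mul_field,
      deriv_comp_affine (f := deriv fun z => (L.weierstrassP z)⁻¹)]
    simp only
    rw [hx]
    ring
  · rw [hdp.self_of_nhds, hd]
    simp [deriv_inv_weierstrassP_zero]

/-- The duplication formula for the lemniscatic `℘`. -/
theorem sq_weierstrassP_sq_add {z : ℂ} (hz : z ∉ L.lattice) (h2z : 2 * z ∉ L.lattice) :
    (L.weierstrassP z ^ 2 + 1 / 4) ^ 2 = L.weierstrassP (2 * z) * L.derivWeierstrassP z ^ 2 := by
  have hP := L.meromorphic_weierstrassP
  have hP' := L.meromorphic_derivWeierstrassP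
  have hP2 := meromorphic_comp_affine 0 hP 2
  have h2 := tendsto_affine_nhdsNE 0 (two_ne_zero (α := ℂ)) 0
  rw [mul_zero, add_zero] at h2
  have e : (fun z => (L.weierstrassP z ^ 2 + 1 / 4) ^ 2) =ᶠ[𝓝[≠] 0]
      fun z => L.weierstrassP (0 + 2 * z) * L.derivWeierstrassP z ^ 2 := by
    filter_upwards [eventually_regular_zero (L := L),
      hL.inv_weierstrassP_two_mul_eventuallyEq.filter_mono nhdsWithin_le_nhds,
      h2.eventually (eventually_weierstrassP_ne_zero L)] with x hx hx2 hx0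
    obtain ⟨-, -, hD⟩ := hx
    rw [scExt, mul_pow, div_pow] at hx2
    generalize L.weierstrassP (0 + 2 * x) = A at *
    have hD2 := pow_ne_zero 2 hD
    generalize (L.weierstrassP x ^ 2 + 1 / 4) ^ 2 = B at *
    field_simp at hx2
    linear_combination -hx2 / 4
  have e' := eventuallyEq_nhdsNE_of_meromorphic (by fun_prop) (by fun_prop) e z
  have c₁ := (L.analyticOnNhd_weierstrassP z hz).continuousAt
  have c₂ := (L.analyticOnNhd_derivWeierstrassP z hz).continuousAt
  have c₃ : ContinuousAt (fun x => L.weierstrassP (0 + 2 * x)) z :=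
    ContinuousAt.comp' (g := L.weierstrassP) (f := fun x => 0 + 2 * x)
      (L.analyticOnNhd_weierstrassP _ (by simpa using h2z)).continuousAt (by fun_prop)
  have := (eventuallyEq_nhds_of_nhdsNE (by fun_prop) (by fun_prop) e').self_of_nhds
  simpa using this

end IsLemniscatic

/-! ### The arc length integral and the travel time -/

/-- The hyperbolic lemniscatic arc length `∫₀ˣ dτ / √(1 + τ⁴)`. -/
noncomputable def arc (x : ℝ) : ℝ := ∫ τ in (0 : ℝ)..x, 1 / Real.sqrt (1 + τ ^ 4)

theorem hasDerivAt_arc (x : ℝ) : HasDerivAt arc (1 / Real.sqrt (1 + x ^ 4)) x := by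
  have hc : Continuous fun τ : ℝ => 1 / Real.sqrt (1 + τ ^ 4) :=
    continuous_const.div (by fun_prop) fun τ => (Real.sqrt_pos.2 (by positivity)).ne'
  exact (hc.integral_hasStrictDerivAt 0 x).hasDerivAt

theorem arc_neg (x : ℝ) : arc (-x) = -arc x := by
  have := intervalIntegral.integral_comp_neg (a := 0) (b := x)
    (fun τ : ℝ => 1 / Real.sqrt (1 + τ ^ 4))
  simp only [Even.neg_pow, show Even 4 by decide] at this
  rw [arc, arc, this, neg_zero, intervalIntegral.integral_symm]

theorem arc_nonneg {x : ℝ} (hx : 0 ≤ x) : 0 ≤ arc x :=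
  intervalIntegral.integral_nonneg hx fun τ _ => by positivity

theorem arc_abs (x : ℝ) : arc |x| = |arc x| := by
  rcases le_total 0 x with h | h
  · rw [abs_of_nonneg h, abs_of_nonneg (arc_nonneg h)]
  · have := arc_nonneg (neg_nonneg.2 h)
    rw [abs_of_nonpos h, arc_neg] at *
    rw [abs_of_nonpos (by linarith)]

theorem abs_arc_le (x : ℝ) : |arc x| ≤ |x| := by
  have := intervalIntegral.norm_integral_le_of_norm_le_const (a := 0) (b := x) (C := 1)
    (f := fun τ : ℝ => 1 / Real.sqrt (1 + τ ^ 4)) fun τ _ => by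
      have h4 : 0 ≤ τ ^ 4 := by positivity
      rw [Real.norm_of_nonneg (by positivity)]
      exact div_le_one_of_le₀ (Real.one_le_sqrt.2 (by linarith)) (Real.sqrt_nonneg _)
  simpa [arc] using this

/-- The form `dτ/√(1 + τ⁴)` changes sign under `τ ↦ 1/τ`, so the sum is constant; at `x = 1` it is
twice `arc 1`. -/
theorem arc_add_arc_inv {x : ℝ} (hx : 0 < x) : arc x + arc x⁻¹ = omega := by
  have hd : ∀ y ∈ Set.Ioi (0 : ℝ), HasDerivAt (fun y => arc y + arc y⁻¹) 0 y := fun y hy => by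
    have hy : 0 < y := hy
    refine ((hasDerivAt_arc y).add
      ((hasDerivAt_arc y⁻¹).comp y (hasDerivAt_inv hy.ne'))).congr_deriv ?_
    have : Real.sqrt (1 + y ^ 4) = y ^ 2 * Real.sqrt (1 + y⁻¹ ^ 4) := by
      rw [← Real.sqrt_sq (sq_nonneg y)]
      rw [← Real.sqrt_mul (by positivity)]
      congr 1
      field_simp
      ring
    rw [this]
    have h2 : 0 < Real.sqrt (1 + y⁻¹ ^ 4) := Real.sqrt_pos.2 (by positivity)
    field_simp
    ring
  have := isOpen_Ioi.is_const_of_deriv_eq_zero isPreconnected_Ioi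
    (fun y hy => (hd y hy).differentiableAt.differentiableWithinAt)
    (fun y hy => (hd y hy).deriv) (Set.mem_Ioi.2 hx) (Set.mem_Ioi.2 one_pos)
  rw [this, inv_one, ← two_mul]
  rfl

theorem abs_arc_eq {x : ℝ} (hx : x ≠ 0) : |arc x| = omega - |arc x⁻¹| := by
  rw [← arc_abs, ← arc_abs, abs_inv, ← arc_add_arc_inv (abs_pos.2 hx)]
  ring

/-- The time that a solution of `x'² = 4x³ - x` needs to come from infinity to `½`. -/
theorem eq_omega_of_ode {x x' : ℝ → ℝ} {a : ℝ} (ha : 0 < a)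
    (hx : ∀ t ∈ Set.Ioo 0 a, HasDerivAt x (x' t) t)
    (hx' : ∀ t ∈ Set.Ioo 0 a, HasDerivAt x' (6 * x t ^ 2 - 1 / 2) t)
    (hsq : ∀ t ∈ Set.Ioo 0 a, x' t ^ 2 = 4 * x t ^ 3 - x t)
    (hlt : ∀ t ∈ Set.Ioo 0 a, 1 / 2 < x t)
    (h0 : Tendsto (fun t => (x t)⁻¹) (𝓝[>] 0) (𝓝 0))
    (h1 : Tendsto x (𝓝[<] a) (𝓝 (1 / 2))) : a = omega := by
  -- This `v` is a square root of `x - 1/(4x)` that is differentiable without choosing a sign, and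
  -- `v' = -√(1 + v⁴)`. Hence `arc (v t) + t` is constant.
  set v : ℝ → ℝ := fun t => -2 * (x t ^ 2 - 1 / 4) / x' t with hv
  have hpos : ∀ t ∈ Set.Ioo 0 a, 0 < x t ^ 2 - 1 / 4 := fun t ht => by nlinarith [hlt t ht]
  have hx0 : ∀ t ∈ Set.Ioo 0 a, 0 < x t := fun t ht => by linarith [hlt t ht]
  have hsq' : ∀ t ∈ Set.Ioo 0 a, x' t ^ 2 = 4 * x t * (x t ^ 2 - 1 / 4) := fun t ht => by
    rw [hsq t ht]; ring
  have hne : ∀ t ∈ Set.Ioo 0 a, x' t ≠ 0 := fun t ht h => by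
    have h1 := hsq' t ht
    have h2 := mul_pos (hx0 t ht) (hpos t ht)
    rw [h] at h1
    nlinarith
  have hv2 : ∀ t ∈ Set.Ioo 0 a, v t ^ 2 = (x t ^ 2 - 1 / 4) / x t := fun t ht => by
    have h1 := (hpos t ht).ne'
    have h2 := (hx0 t ht).ne'
    simp only [hv]
    rw [div_pow, hsq' t ht, div_eq_div_iff (by positivity) h2]
    ring
  have hv' : ∀ t ∈ Set.Ioo 0 a, HasDerivAt v (-((x t ^ 2 + 1 / 4) / x t)) t := fun t ht => by
    have h1 := (hpos t ht).ne'
    have h2 := (hx0 t ht).ne'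
    refine (((((hx t ht).fun_pow 2).sub_const (1 / 4)).const_mul (-2)).fun_div
      (hx' t ht) (hne t ht)).congr_deriv ?_
    rw [hsq' t ht, ← neg_div, div_eq_div_iff (by positivity) h2]
    push_cast
    linear_combination (-4 * x t ^ 2) * hsq' t ht
  have harc : ∀ t ∈ Set.Ioo 0 a, HasDerivAt (fun t => arc (v t) + t) 0 t := fun t ht => by
    have h2 := hx0 t ht
    refine (((hasDerivAt_arc (v t)).comp t (hv' t ht)).add (hasDerivAt_id t)).congr_deriv ?_
    have : 1 + v t ^ 4 = ((x t ^ 2 + 1 / 4) / x t) ^ 2 := by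
      rw [show v t ^ 4 = (v t ^ 2) ^ 2 by ring, hv2 t ht]
      field_simp
      ring
    rw [this, Real.sqrt_sq (by positivity)]
    field_simp
    ring
  have hconst : ∀ t ∈ Set.Ioo 0 a, arc (v t) + t = arc (v (a / 2)) + a / 2 := fun t ht =>
    isOpen_Ioo.is_const_of_deriv_eq_zero isPreconnected_Ioo
      (fun y hy => (harc y hy).differentiableAt.differentiableWithinAt)
      (fun y hy => (harc y hy).deriv) ht ⟨by linarith, by linarith⟩
  set C := arc (v (a / 2)) + a / 2
  have hCa : C = a := by
    have hlim : Tendsto (fun t => arc (v t)) (𝓝[<] a) (𝓝 0) := by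
      refine squeeze_zero_norm' (a := fun t => Real.sqrt ((x t ^ 2 - 1 / 4) / x t)) ?_ ?_
      · filter_upwards [Ioo_mem_nhdsLT ha] with t ht
        rw [← hv2 t ht, Real.sqrt_sq_eq_abs]
        exact abs_arc_le _
      · have := (((h1.pow 2).sub_const (1 / 4)).div h1 (by norm_num)).sqrt
        norm_num at this
        simpa using this
    have h2 : Tendsto (fun t => arc (v t) + t) (𝓝[<] a) (𝓝 (0 + a)) :=
      hlim.add (tendsto_id.mono_left nhdsWithin_le_nhds)
    rw [zero_add] at h2
    refine tendsto_nhds_unique (tendsto_const_nhds.congr' ?_) h2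
    filter_upwards [Ioo_mem_nhdsLT ha] with t ht
    exact (hconst t ht).symm
  -- As `t → 0` the function `v` is unbounded, so the limit is taken through `1/v`. Absolute values
  -- make the sign of `v` irrelevant.
  have hlim : Tendsto (fun t => arc (v t)⁻¹) (𝓝[>] 0) (𝓝 0) := by
    refine squeeze_zero_norm' (a := fun t => Real.sqrt ((x t)⁻¹ / (1 - (x t)⁻¹ ^ 2 / 4))) ?_ ?_
    · filter_upwards [Ioo_mem_nhdsGT ha] with t ht
      have h1 := (hpos t ht).ne'
      have h2 := (hx0 t ht).ne'
      have : (x t)⁻¹ / (1 - (x t)⁻¹ ^ 2 / 4) = (v t)⁻¹ ^ 2 := by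
        have h3 : 4 * x t ^ 2 - 1 ≠ 0 := fun h => h1 (by linear_combination h / 4)
        rw [inv_pow (v t), hv2 t ht]
        field_simp
      rw [this, Real.sqrt_sq_eq_abs]
      exact abs_arc_le _
    · have := (h0.div (((h0.pow 2).div_const 4).const_sub 1) (by norm_num)).sqrt
      simpa using this
  have hlim2 : Tendsto (fun t => omega - |arc (v t)⁻¹|) (𝓝[>] 0) (𝓝 (omega - |0|)) :=
    hlim.abs.const_sub _
  have hlim3 : Tendsto (fun t => |C - t|) (𝓝[>] 0) (𝓝 |C - 0|) :=
    ((tendsto_id.mono_left nhdsWithin_le_nhds).const_sub C).abs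
  have := tendsto_nhds_unique (hlim3.congr' ?_) hlim2
  · rw [hCa] at this
    simpa [abs_of_pos ha] using this
  filter_upwards [Ioo_mem_nhdsGT ha] with t ht
  have hvne : v t ≠ 0 := fun h => by
    have h1 := hv2 t ht
    have h2 := div_pos (hpos t ht) (hx0 t ht)
    rw [h] at h1
    nlinarith
  rw [← abs_arc_eq hvne, ← hconst t ht, add_sub_cancel_right]

/-! ### The real period and the lattice -/

namespace IsLemniscatic

variable {L : PeriodPair}

theorem tendsto_sq_mul_weierstrassP :
    Tendsto (fun z => z ^ 2 * L.weierstrassP z) (𝓝[≠] 0) (𝓝 1) := by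
  have h : ContinuousAt (fun z => z ^ 2 * L.weierstrassPExcept 0 z + 1) 0 := by
    have := (L.analyticAt_weierstrassPExcept 0).continuousAt
    fun_prop
  refine (h.tendsto.mono_left nhdsWithin_le_nhds).congr' ?_ |>.trans (by simp)
  filter_upwards [self_mem_nhdsWithin] with z hz
  have hz : z ≠ 0 := hz
  have := L.weierstrassPExcept_add 0 z
  simp only [ZeroMemClass.coe_zero, sub_zero] at this
  rw [← this]
  field_simp
  simp

theorem tendsto_ofReal_nhdsGT_zero : Tendsto ((↑) : ℝ → ℂ) (𝓝[>] 0) (𝓝[≠] 0) := by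
  refine tendsto_nhdsWithin_of_tendsto_nhds_of_eventually_within _
    ((Complex.continuous_ofReal.tendsto' 0 0 (by simp)).mono_left nhdsWithin_le_nhds) ?_
  filter_upwards [self_mem_nhdsWithin] with t ht
  simpa using (Set.mem_Ioi.1 ht).ne'

variable (hL : IsLemniscatic L)
include hL

theorem ofReal_re_weierstrassP (t : ℝ) :
    (((L.weierstrassP t).re : ℝ) : ℂ) = L.weierstrassP t :=
  Complex.conj_eq_iff_re.1 (by rw [← hL.weierstrassP_conj, Complex.conj_ofReal])

theorem ofReal_re_derivWeierstrassP (t : ℝ) :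
    (((L.derivWeierstrassP t).re : ℝ) : ℂ) = L.derivWeierstrassP t := by
  refine Complex.conj_eq_iff_re.1 ?_
  have h : starRingEnd ℂ ∘ L.weierstrassP ∘ starRingEnd ℂ = L.weierstrassP := by
    ext z
    simp [hL.weierstrassP_conj]
  have h' := deriv_conj_conj (f := L.weierstrassP)
  rw [h, L.deriv_weierstrassP] at h'
  simpa using (congrFun h' t).symm

theorem exists_ofReal_mem_lattice : ∃ t : ℝ, t ≠ 0 ∧ (t : ℂ) ∈ L.lattice := by
  have hre : ∀ l ∈ L.lattice, ((2 * l.re : ℝ) : ℂ) ∈ L.lattice := fun l hl => by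
    rw [← Complex.add_conj]
    exact add_mem hl (hL.conj_mem_lattice hl)
  have h0 : L.ω₁ ≠ 0 := fun h => L.ω₁_div_two_notMem_lattice (by simp [h])
  by_cases h : L.ω₁.re = 0
  · refine ⟨2 * (Complex.I * L.ω₁).re, fun h' => h0 (Complex.ext h ?_),
      hre _ (hL.I_mul_mem_lattice L.ω₁_mem_lattice)⟩
    simpa using h'
  · exact ⟨2 * L.ω₁.re, by simpa using h, hre _ L.ω₁_mem_lattice⟩

/-- The real periods form a subgroup of `ℝ`, dense or cyclic. Discreteness near `0` excludes
density, and `l + l̄` provides a nonzero element. -/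
theorem exists_real_period : ∃ a : ℝ, 0 < a ∧ ((2 * a : ℝ) : ℂ) ∈ L.lattice ∧
    ∀ t : ℝ, (t : ℂ) ∈ L.lattice → ∃ n : ℤ, t = n * (2 * a) := by
  let G : AddSubgroup ℝ := L.lattice.toAddSubgroup.comap Complex.ofRealHom.toAddMonoidHom
  have hG : ∀ t : ℝ, t ∈ G ↔ (t : ℂ) ∈ L.lattice := fun t => Iff.rfl
  rcases G.dense_or_cyclic with hd | ⟨g, hg⟩
  · exfalso
    obtain ⟨ε, hε, h⟩ := mem_nhdsGT_iff_exists_Ioo_subset.1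
      (tendsto_ofReal_nhdsGT_zero.eventually (eventually_notMem_lattice L 0))
    obtain ⟨t, ht, htG⟩ := hd.exists_mem_open isOpen_Ioo (Set.nonempty_Ioo.2 hε)
    exact h htG ht
  · have hmem : ∀ t : ℝ, (t : ℂ) ∈ L.lattice → ∃ n : ℤ, t = n * g := fun t ht => by
      rw [← hG, hg, AddSubgroup.mem_closure_singleton] at ht
      obtain ⟨n, hn⟩ := ht
      exact ⟨n, by rw [← hn, zsmul_eq_mul]⟩
    have hgm : (g : ℂ) ∈ L.lattice := by
      rw [← hG, hg]
      exact AddSubgroup.mem_closure_singleton_self g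
    have hg0 : g ≠ 0 := by
      rintro rfl
      obtain ⟨t, ht, htL⟩ := hL.exists_ofReal_mem_lattice
      obtain ⟨n, hn⟩ := hmem t htL
      exact ht (by simpa using hn)
    refine ⟨|g| / 2, half_pos (abs_pos.2 hg0), ?_, fun t ht => ?_⟩
    · rw [mul_div_cancel₀ _ two_ne_zero]
      rcases abs_choice g with h | h <;> rw [h]
      · exact hgm
      · simpa using hgm
    · obtain ⟨n, hn⟩ := hmem t ht
      rw [mul_div_cancel₀ _ two_ne_zero]
      rcases abs_choice g with h | h <;> rw [h]
      · exact ⟨n, hn⟩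
      · exact ⟨-n, by rw [hn]; push_cast; ring⟩

theorem real_period_eq {a : ℝ} (ha : 0 < a) (h2a : ((2 * a : ℝ) : ℂ) ∈ L.lattice)
    (hmin : ∀ t : ℝ, (t : ℂ) ∈ L.lattice → ∃ n : ℤ, t = n * (2 * a)) :
    a = omega ∧ L.weierstrassP a = 1 / 2 := by
  have hnot : ∀ t ∈ Set.Ioo 0 (2 * a), (t : ℂ) ∉ L.lattice := fun t ht hm => by
    obtain ⟨n, rfl⟩ := hmin t hm
    have h1 : 0 < n := by
      have := pos_of_mul_pos_left ht.1 (by linarith)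
      exact_mod_cast this
    have h2 : (1 : ℝ) ≤ n := by exact_mod_cast h1
    nlinarith [ht.2]
  have hIoo : ∀ t ∈ Set.Ioo 0 a, t ∈ Set.Ioo 0 (2 * a) := fun t ht => ⟨ht.1, by linarith [ht.2]⟩
  set x : ℝ → ℝ := fun t => (L.weierstrassP t).re
  set x' : ℝ → ℝ := fun t => (L.derivWeierstrassP t).re
  have hxc : ∀ t, ((x t : ℝ) : ℂ) = L.weierstrassP t := hL.ofReal_re_weierstrassP
  have hxc' : ∀ t, ((x' t : ℝ) : ℂ) = L.derivWeierstrassP t := hL.ofReal_re_derivWeierstrassP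
  have hx : ∀ t ∈ Set.Ioo 0 (2 * a), HasDerivAt x (x' t) t := fun t ht =>
    (hasDerivAt_weierstrassP L (hnot t ht)).real_of_complex
  have hx' : ∀ t ∈ Set.Ioo 0 (2 * a), HasDerivAt x' (6 * x t ^ 2 - 1 / 2) t := fun t ht => by
    refine (hL.hasDerivAt_derivWeierstrassP (hnot t ht)).real_of_complex.congr_deriv ?_
    have : 6 * L.weierstrassP t ^ 2 - 1 / 2 = ((6 * x t ^ 2 - 1 / 2 : ℝ) : ℂ) := by
      rw [← hxc t]
      push_cast
      ring
    rw [this, Complex.ofReal_re]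
  have hsq : ∀ t ∈ Set.Ioo 0 (2 * a), x' t ^ 2 = 4 * x t ^ 3 - x t := fun t ht => by
    have := hL.derivWeierstrassP_sq (hnot t ht)
    rw [← hxc, ← hxc'] at this
    exact_mod_cast this
  -- The value `1/2` is a root of `4x³ - x`, so `℘'` would vanish and `2t < 2a` would be a period.
  -- Being large near `0`, `x` therefore stays above `1/2`.
  have hne : ∀ t ∈ Set.Ioo 0 a, x t ≠ 1 / 2 := fun t ht h => by
    have h1 := hsq t (hIoo t ht)
    rw [h] at h1
    have h2 : x' t = 0 := by
      refine pow_eq_zero_iff two_ne_zero |>.1 (h1.trans (by norm_num))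
    have h3 := add_self_mem_lattice_of_derivWeierstrassP_eq_zero L (u := t)
      (by rw [← hxc', h2, Complex.ofReal_zero])
    exact hnot (t + t) ⟨by linarith [ht.1], by linarith [ht.2]⟩ (by exact_mod_cast h3)
  obtain ⟨t₀, ht₀, hxt₀⟩ : ∃ t ∈ Set.Ioo 0 a, 1 / 2 < x t := by
    have h1 : Tendsto (fun t : ℝ => t ^ 2 * x t) (𝓝[>] 0) (𝓝 1) := by
      have := (Complex.continuous_re.tendsto 1).comp
        ((tendsto_sq_mul_weierstrassP (L := L)).comp tendsto_ofReal_nhdsGT_zero)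
      refine this.congr fun t => ?_
      simp only [Function.comp_apply, ← hxc]
      norm_cast
    obtain ⟨t, h1, h2, h3⟩ := ((h1.eventually (lt_mem_nhds (show (1 : ℝ) / 2 < 1 by norm_num))).and
      ((show ∀ᶠ t in 𝓝[>] (0 : ℝ), t ∈ Set.Ioo 0 a from Ioo_mem_nhdsGT ha).and
      (show ∀ᶠ t in 𝓝[>] (0 : ℝ), t ∈ Set.Ioo 0 1 from Ioo_mem_nhdsGT one_pos))).exists
    refine ⟨t, h2, ?_⟩
    have : t ^ 2 < 1 := by nlinarith [h3.1, h3.2]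
    have ht : 0 < t ^ 2 := by nlinarith [h3.1]
    nlinarith
  have hlt : ∀ t ∈ Set.Ioo 0 a, 1 / 2 < x t := fun t ht => by
    by_contra hle
    obtain ⟨y, hy, hy'⟩ := isPreconnected_Ioo.intermediate_value ht ht₀
      (fun y hy => (hx y (hIoo y hy)).continuousAt.continuousWithinAt)
      ⟨not_lt.1 hle, hxt₀.le⟩
    exact hne y hy hy'
  have haI : a ∈ Set.Ioo 0 (2 * a) := ⟨ha, by linarith⟩
  have hlim : Tendsto x (𝓝[<] a) (𝓝 (x a)) :=
    (hx a haI).continuousAt.tendsto.mono_left nhdsWithin_le_nhds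
  have hxa : x a = 1 / 2 := by
    have h1 : 1 / 2 ≤ x a := ge_of_tendsto hlim (by
      filter_upwards [Ioo_mem_nhdsLT ha] with t ht using (hlt t ht).le)
    have h2 : x' a = 0 := by
      have := derivWeierstrassP_eq_zero_of_add_self_mem L (u := a)
        (by rw [← two_mul]; exact_mod_cast h2a)
      simp [x', this]
    have h3 := hsq a haI
    rw [h2] at h3
    -- At the half-period `a` the cubic vanishes; of its roots `0`, `±1/2` only `1/2` satisfies `x a
    -- ≥ 1/2`.
    have h4 : x a * (x a + 1 / 2) * (x a - 1 / 2) = 0 := by linear_combination -h3 / 4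
    have h5 : x a * (x a + 1 / 2) ≠ 0 := by positivity
    linarith [(mul_eq_zero.1 h4).resolve_left h5]
  refine ⟨eq_omega_of_ode ha (fun t ht => hx t (hIoo t ht)) (fun t ht => hx' t (hIoo t ht))
    (fun t ht => hsq t (hIoo t ht)) hlt ?_ (hxa ▸ hlim), ?_⟩
  · have h := ((analyticAt_inv_weierstrassP_zero L).continuousAt.tendsto.mono_left
      nhdsWithin_le_nhds).comp tendsto_ofReal_nhdsGT_zero
    have h' := (Complex.continuous_re.tendsto _).comp h
    simp only [PeriodPair.weierstrassP_zero, inv_zero, Complex.zero_re] at h'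
    refine h'.congr fun t => ?_
    simp only [Function.comp_apply, ← hxc]
    norm_cast
  · rw [← hxc, hxa]
    norm_num

theorem omega_pos_and_two_omega_mem : 0 < omega ∧ ((2 * omega : ℝ) : ℂ) ∈ L.lattice ∧
    (∀ t : ℝ, (t : ℂ) ∈ L.lattice → ∃ n : ℤ, t = n * (2 * omega)) ∧
    L.weierstrassP omega = 1 / 2 := by
  obtain ⟨a, ha, h2a, hmin⟩ := hL.exists_real_period
  obtain ⟨rfl, h⟩ := hL.real_period_eq ha h2a hmin
  exact ⟨ha, h2a, hmin, h⟩

theorem weierstrassP_omega : L.weierstrassP omega = 1 / 2 := hL.omega_pos_and_two_omega_mem.2.2.2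

theorem two_omega_mem : 2 * (omega : ℂ) ∈ L.lattice := by
  exact_mod_cast hL.omega_pos_and_two_omega_mem.2.1

theorem two_I_omega_mem : 2 * Complex.I * (omega : ℂ) ∈ L.lattice := by
  have := hL.I_mul_mem_lattice hL.two_omega_mem
  rwa [show 2 * Complex.I * (omega : ℂ) = Complex.I * (2 * omega) by ring]

theorem int_mul_mem (m n : ℤ) :
    m * (2 * (omega : ℂ)) + n * (2 * Complex.I * (omega : ℂ)) ∈ L.lattice := by
  have h₁ := L.lattice.smul_mem m hL.two_omega_mem
  have h₂ := L.lattice.smul_mem n hL.two_I_omega_mem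
  simpa using add_mem h₁ h₂

theorem omega_notMem : (omega : ℂ) ∉ L.lattice := fun h => by
  have := hL.weierstrassP_omega
  rw [L.weierstrassP_coe ⟨_, h⟩] at this
  norm_num at this

theorem I_omega_notMem : Complex.I * (omega : ℂ) ∉ L.lattice := fun h => by
  have := hL.weierstrassP_I_mul omega
  rw [L.weierstrassP_coe ⟨_, h⟩, hL.weierstrassP_omega] at this
  norm_num at this

/-- Otherwise `iω` would be congruent to `-ω`, forcing `-1/2 = 1/2`. -/
theorem omega_add_I_omega_notMem : (omega : ℂ) + Complex.I * (omega : ℂ) ∉ L.lattice := fun h => by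
  have h₁ := hL.weierstrassP_I_mul omega
  have h₂ := L.weierstrassP_add_coe (-omega) ⟨_, h⟩
  simp only [neg_add_cancel_left, L.weierstrassP_neg] at h₂
  rw [h₂, hL.weierstrassP_omega] at h₁
  norm_num at h₁

theorem mem_lattice_iff_int {m n : ℤ} :
    m * (omega : ℂ) + n * (Complex.I * omega) ∈ L.lattice ↔ Even m ∧ Even n := by
  have hsub : ∀ j k : ℤ, ∀ z ∈ L.lattice,
      z - (j * (2 * (omega : ℂ)) + k * (2 * Complex.I * (omega : ℂ))) ∈ L.lattice :=
    fun j k z hz => sub_mem hz (hL.int_mul_mem j k)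
  constructor
  · intro h
    rcases Int.even_or_odd' m with ⟨j, rfl | rfl⟩ <;> rcases Int.even_or_odd' n with ⟨k, rfl | rfl⟩
    · exact ⟨even_two_mul j, even_two_mul k⟩
    · refine absurd ?_ hL.I_omega_notMem
      convert hsub j k _ h using 1
      push_cast
      ring
    · refine absurd ?_ hL.omega_notMem
      convert hsub j k _ h using 1
      push_cast
      ring
    · refine absurd ?_ hL.omega_add_I_omega_notMem
      convert hsub j k _ h using 1
      push_cast
      ring
  · rintro ⟨⟨j, rfl⟩, ⟨k, rfl⟩⟩
    convert hL.int_mul_mem j k using 1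
    push_cast
    ring

theorem lattice_eq : L.lattice = Submodule.span ℤ
    {2 * (omega : ℂ), 2 * Complex.I * (omega : ℂ)} := by
  refine le_antisymm (fun l hl => ?_) (Submodule.span_le.2 ?_)
  · obtain ⟨-, -, hmin, -⟩ := hL.omega_pos_and_two_omega_mem
    -- Adding conjugates places `2 Re l` and `2 Re (il)` among the real periods, so `l` is an
    -- integral combination of `ω` and `iω`; parity finishes.
    obtain ⟨m, hm⟩ := hmin (2 * l.re) (by
      rw [← Complex.add_conj]
      exact add_mem hl (hL.conj_mem_lattice hl))
    obtain ⟨n, hn⟩ := hmin (2 * (Complex.I * l).re) (by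
      rw [← Complex.add_conj]
      exact add_mem (hL.I_mul_mem_lattice hl) (hL.conj_mem_lattice (hL.I_mul_mem_lattice hl)))
    have e : l = m * (omega : ℂ) + (-n : ℤ) * (Complex.I * omega) := by
      refine Complex.ext ?_ ?_
      · simp
        linarith
      · simp at hn ⊢
        linarith
    rw [e, hL.mem_lattice_iff_int] at hl
    obtain ⟨⟨j, hj⟩, ⟨k, hk⟩⟩ := hl
    rw [e, hj, hk]
    refine Submodule.mem_span_pair.2 ⟨j, k, ?_⟩
    simp only [zsmul_eq_mul]
    push_cast
    ring
  · rintro z (rfl | rfl)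
    · exact hL.two_omega_mem
    · exact hL.two_I_omega_mem

end IsLemniscatic

/-! ### Pole points and solutions of the initial value problem -/

theorem mem_polePoints_iff {p : ℂ} : p ∈ polePoints ↔ ∃ m n : ℤ, Odd m ∧ Odd n ∧
    2 * p = m * (omega : ℂ) + n * (Complex.I * omega) := by
  constructor
  · rintro ⟨a, ha, b, hb, m, n, rfl⟩
    have aux : ∀ c ∈ ({1, -1} : Set ℂ), ∃ k : ℤ, Odd k ∧ (k : ℂ) = c := by
      rintro c (rfl | rfl)
      · exact ⟨1, odd_one, by simp⟩
      · exact ⟨-1, by decide, by simp⟩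
    obtain ⟨j, hj, rfl⟩ := aux a ha
    obtain ⟨k, hk, rfl⟩ := aux b hb
    refine ⟨j + 2 * (2 * m), k + 2 * (2 * n), hj.add_even (even_two_mul _),
      hk.add_even (even_two_mul _), ?_⟩
    push_cast
    ring
  · rintro ⟨m, n, hm, hn, h⟩
    -- After doubling, a shift of `p` by `2ω` changes the coefficient by `4`, and the odd residues
    -- modulo `4` are `±1`.
    have aux : ∀ k : ℤ, Odd k → ∃ c ∈ ({1, -1} : Set ℂ), ∃ j : ℤ, (k : ℂ) = c + 4 * j := by
      rintro k ⟨i, rfl⟩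
      rcases Int.even_or_odd' i with ⟨j, rfl | rfl⟩
      · exact ⟨1, by simp, j, by push_cast; ring⟩
      · exact ⟨-1, by simp, j + 1, by push_cast; ring⟩
    obtain ⟨a, ha, j, hj⟩ := aux m hm
    obtain ⟨b, hb, k, hk⟩ := aux n hn
    refine ⟨a, ha, b, hb, j, k, ?_⟩
    rw [hj, hk] at h
    linear_combination h / 2

/-- The normal form upgrades agreement on punctured neighbourhoods to equality of values. -/
theorem eqOn_of_eventuallyEq_zero {f g : ℂ → ℂ} {U : Set ℂ} (hU : IsPreconnected U) (h0 : 0 ∈ U)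
    (hf : MeromorphicNFOn f Set.univ) (hg : ∀ z ∈ U, AnalyticAt ℂ g z) (h : f =ᶠ[𝓝[≠] 0] g) :
    Set.EqOn f g U := fun z hz =>
  ((hf (Set.mem_univ z)).eventuallyEq_nhdsNE_iff_eventuallyEq_nhds (hg z hz).meromorphicNFAt |>.1
    (eventuallyEq_nhdsNE_of_isPreconnected hU (fun x _ => (hf (Set.mem_univ x)).meromorphicAt)
      (fun x hx => (hg x hx).meromorphicAt) h0 hz h)).self_of_nhds

namespace IsIVPSolution

variable {U : Set ℂ} {s c : ℂ → ℂ} (hU : IsOpen U) (hUc : IsPreconnected U) (h0 : (0 : ℂ) ∈ U)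
  (h : IsIVPSolution U s c)

include hU h in
theorem analyticAt_s {z : ℂ} (hz : z ∈ U) : AnalyticAt ℂ s z :=
  DifferentiableOn.analyticAt
    (fun x hx => (h.hasDerivAt_s x hx).differentiableAt.differentiableWithinAt) (hU.mem_nhds hz)

include hU h in
theorem analyticAt_c {z : ℂ} (hz : z ∈ U) : AnalyticAt ℂ c z :=
  DifferentiableOn.analyticAt
    (fun x hx => (h.hasDerivAt_c x hx).differentiableAt.differentiableWithinAt) (hU.mem_nhds hz)

include h in
theorem deriv_mul {z : ℂ} (hz : z ∈ U) :
    deriv (fun z => s z * c z) z = c z ^ 4 - s z ^ 4 := by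
  rw [((h.hasDerivAt_s z hz).fun_mul (h.hasDerivAt_c z hz)).deriv]
  ring

include hU h in
theorem deriv_deriv_mul {z : ℂ} (hz : z ∈ U) :
    deriv (deriv fun z => s z * c z) z = -8 * (s z * c z) ^ 3 := by
  have e : (deriv fun z => s z * c z) =ᶠ[𝓝 z] fun z => c z ^ 4 - s z ^ 4 := by
    filter_upwards [hU.mem_nhds hz] with x hx
    exact h.deriv_mul hx
  rw [e.deriv_eq, (((h.hasDerivAt_c z hz).fun_pow 4).fun_sub
    ((h.hasDerivAt_s z hz).fun_pow 4)).deriv]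
  push_cast
  ring

include hU hUc h0 h in
theorem pow_four_add {z : ℂ} (hz : z ∈ U) :
    c z ^ 4 + s z ^ 4 = 1 := by
  have hd : ∀ y ∈ U, HasDerivAt (fun z => c z ^ 4 + s z ^ 4) 0 y := fun y hy =>
    (((h.hasDerivAt_c y hy).fun_pow 4).fun_add ((h.hasDerivAt_s y hy).fun_pow 4)).congr_deriv
      (by push_cast; ring)
  have := hU.is_const_of_deriv_eq_zero hUc
    (fun y hy => (hd y hy).differentiableAt.differentiableWithinAt)
    (fun y hy => (hd y hy).deriv) hz h0
  simpa [h.s_zero, h.c_zero] using this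

end IsIVPSolution

/-! ### Zeros of the denominator and the poles -/

namespace IsLemniscatic

variable {L : PeriodPair} (hL : IsLemniscatic L)

section

include hL

/-- Such a point `u` is congruent to `iu`, so `℘(u) = ℘(iu) = -℘(u)`. -/
theorem weierstrassP_eq_zero_of_odd {m n : ℤ} (hm : Odd m) (hn : Odd n) :
    L.weierstrassP (m * (omega : ℂ) + n * (Complex.I * omega)) = 0 := by
  set u := m * (omega : ℂ) + n * (Complex.I * omega)
  have hmem : u - Complex.I * u ∈ L.lattice := by
    have h := hL.mem_lattice_iff_int.2 ⟨hm.add_odd hn, hn.sub_odd hm⟩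
    convert h using 1
    push_cast
    linear_combination (-n * (omega : ℂ)) * Complex.I_sq
  have h := L.weierstrassP_add_coe (Complex.I * u) ⟨_, hmem⟩
  rw [add_sub_cancel, hL.weierstrassP_I_mul] at h
  exact CharZero.eq_neg_self_iff.1 h

/-- A zero of `℘` is also a zero of `℘'`, hence a half-period; the classes of `ω` and `iω` carry the
values `±1/2`. -/
theorem weierstrassP_eq_zero_iff {u : ℂ} (hu : u ∉ L.lattice) : L.weierstrassP u = 0 ↔
    ∃ m n : ℤ, Odd m ∧ Odd n ∧ u = m * (omega : ℂ) + n * (Complex.I * omega) := by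
  constructor
  · intro h
    have hd : L.derivWeierstrassP u = 0 := by
      have := hL.derivWeierstrassP_sq hu
      simpa [h] using this
    have h2 := add_self_mem_lattice_of_derivWeierstrassP_eq_zero L hd
    rw [hL.lattice_eq] at h2
    obtain ⟨m, n, hmn⟩ := Submodule.mem_span_pair.1 h2
    simp only [zsmul_eq_mul] at hmn
    have e : u = m * (omega : ℂ) + n * (Complex.I * omega) := by linear_combination -hmn / 2
    have hper : ∀ v, u - v ∈ L.lattice → L.weierstrassP v = 0 := fun v hv => by
      have := L.weierstrassP_add_coe v ⟨_, hv⟩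
      rwa [add_sub_cancel, h, eq_comm] at this
    rcases Int.even_or_odd m with hm | hm <;> rcases Int.even_or_odd n with hn | hn
    · exact absurd (e ▸ hL.mem_lattice_iff_int.2 ⟨hm, hn⟩) hu
    · have := hper (Complex.I * omega) (by
        convert hL.mem_lattice_iff_int.2 ⟨hm, hn.sub_odd odd_one⟩ using 1
        rw [e]
        push_cast
        ring)
      rw [hL.weierstrassP_I_mul, hL.weierstrassP_omega] at this
      norm_num at this
    · have := hper omega (by
        convert hL.mem_lattice_iff_int.2 ⟨hm.sub_odd odd_one, hn⟩ using 1
        rw [e]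
        push_cast
        ring)
      rw [hL.weierstrassP_omega] at this
      norm_num at this
    · exact ⟨m, n, hm, hn, e⟩
  · rintro ⟨m, n, hm, hn, rfl⟩
    exact hL.weierstrassP_eq_zero_of_odd hm hn

theorem two_mul_notMem_of_mem_polePoints {z : ℂ} (hz : z ∈ polePoints) : 2 * z ∉ L.lattice := by
  obtain ⟨m, n, hm, hn, h⟩ := mem_polePoints_iff.1 hz
  rw [h, hL.mem_lattice_iff_int]
  exact fun h => (Int.not_even_iff_odd.2 hm) h.1

theorem notMem_of_mem_polePoints {z : ℂ} (hz : z ∈ polePoints) : z ∉ L.lattice := fun h =>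
  hL.two_mul_notMem_of_mem_polePoints hz (by rw [two_mul]; exact add_mem h h)

/-- When `℘² = -¼`, the cubic relation becomes `℘'² = -2℘`. -/
theorem derivWeierstrassP_ne_zero {z : ℂ} (hz : z ∉ L.lattice)
    (hD : L.weierstrassP z ^ 2 + 1 / 4 = 0) : L.derivWeierstrassP z ≠ 0 := fun h => by
  have h1 := hL.derivWeierstrassP_sq hz
  rw [h] at h1
  have h2 : L.weierstrassP z = 0 := by linear_combination (2 * L.weierstrassP z) * hD - h1 / -2
  rw [h2] at hD
  norm_num at hD

theorem sq_add_quarter_eq_zero_iff {z : ℂ} (hz : z ∉ L.lattice) :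
    L.weierstrassP z ^ 2 + 1 / 4 = 0 ↔ z ∈ polePoints := by
  constructor
  · intro hD
    have hd := hL.derivWeierstrassP_ne_zero hz hD
    have h2z : 2 * z ∉ L.lattice := fun h =>
      hd (derivWeierstrassP_eq_zero_of_add_self_mem L (by rwa [← two_mul]))
    have h := hL.sq_weierstrassP_sq_add hz h2z
    rw [hD, zero_pow two_ne_zero, eq_comm, mul_eq_zero_iff_right (pow_ne_zero 2 hd)] at h
    exact mem_polePoints_iff.2 ((hL.weierstrassP_eq_zero_iff h2z).1 h)
  · intro hp
    have h2z := hL.two_mul_notMem_of_mem_polePoints hp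
    have h := hL.sq_weierstrassP_sq_add hz h2z
    rw [(hL.weierstrassP_eq_zero_iff h2z).2 (mem_polePoints_iff.1 hp), zero_mul] at h
    exact pow_eq_zero_iff two_ne_zero |>.1 h

theorem meromorphicOrderAt_eq_neg_one {f g : ℂ → ℂ} {z : ℂ} (hz : z ∈ polePoints)
    (hg : AnalyticAt ℂ g z) (hgz : g z ≠ 0)
    (hf : ∀ x ∉ L.lattice, f x = g x / (L.weierstrassP x ^ 2 + 1 / 4)) :
    meromorphicOrderAt f z = -1 := by
  have hzL := hL.notMem_of_mem_polePoints hz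
  have hD := (hL.sq_add_quarter_eq_zero_iff hzL).2 hz
  have hP := L.analyticOnNhd_weierstrassP z hzL
  have hDa : AnalyticAt ℂ (fun x => L.weierstrassP x ^ 2 + 1 / 4) z :=
    (hP.fun_pow 2).add analyticAt_const
  -- The derivative `2℘℘'` is nonzero, so the denominator has a simple zero.
  have hd : deriv (fun x => L.weierstrassP x ^ 2 + 1 / 4) z ≠ 0 := by
    rw [(((hasDerivAt_weierstrassP L hzL).fun_pow 2).add_const (1 / 4)).deriv]
    refine mul_ne_zero (mul_ne_zero (by norm_num) (pow_ne_zero _ fun h => ?_))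
      (hL.derivWeierstrassP_ne_zero hzL hD)
    rw [h] at hD
    norm_num at hD
  have h1 : meromorphicOrderAt (fun x => L.weierstrassP x ^ 2 + 1 / 4) z = 1 := by
    have := hDa.analyticOrderAt_sub_eq_one_of_deriv_ne_zero hd
    simp only [hD, sub_zero] at this
    rw [hDa.meromorphicOrderAt_eq, this]
    rfl
  have e : f =ᶠ[𝓝[≠] z] g * fun x => (L.weierstrassP x ^ 2 + 1 / 4)⁻¹ := by
    filter_upwards [eventually_notMem_lattice L z] with x hx
    rw [hf x hx, div_eq_mul_inv, Pi.mul_apply]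
  rw [meromorphicOrderAt_congr e, meromorphicOrderAt_mul_of_ne_zero hg hgz,
    fun_meromorphicOrderAt_inv, h1]

theorem linearIndependent_periods :
    LinearIndependent ℝ ![2 * (omega : ℂ), 2 * Complex.I * omega] := by
  have h0 : 2 * (omega : ℂ) ≠ 0 := by
    have := hL.omega_pos_and_two_omega_mem.1
    exact mul_ne_zero two_ne_zero (by exact_mod_cast this.ne')
  have := (squarePair _ h0).indep
  rwa [show (squarePair _ h0).ω₂ = 2 * Complex.I * omega from mul_right_comm _ _ _] at this

/-- An `L`-periodic function of the form `g / (℘² + ¼)`, regular at the lattice points, is elliptic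
with simple poles exactly at the zeros of `℘² + ¼`. -/
theorem isElliptic_of_eq_div {f g : ℂ → ℂ} (hper : ∀ l ∈ L.lattice, Function.Periodic f l)
    (h0 : AnalyticAt ℂ f 0) (hg : ∀ z ∉ L.lattice, AnalyticAt ℂ g z)
    (hg0 : ∀ z ∉ L.lattice, L.weierstrassP z ^ 2 + 1 / 4 = 0 → g z ≠ 0)
    (hf : ∀ x ∉ L.lattice, f x = g x / (L.weierstrassP x ^ 2 + 1 / 4)) :
    IsElliptic (2 * omega) (2 * Complex.I * omega) f ∧ HasSimplePolesExactlyAt f polePoints := by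
  have hpole : ∀ z ∈ polePoints, meromorphicOrderAt f z = -1 := fun z hz => by
    have hzL := hL.notMem_of_mem_polePoints hz
    exact hL.meromorphicOrderAt_eq_neg_one hz (hg z hzL)
      (hg0 z hzL ((hL.sq_add_quarter_eq_zero_iff hzL).2 hz)) hf
  have hreg : ∀ z ∉ polePoints, AnalyticAt ℂ f z := fun z hz => by
    by_cases hzL : z ∈ L.lattice
    · exact analyticAt_of_periodic h0 (hper z hzL)
    have hD : L.weierstrassP z ^ 2 + 1 / 4 ≠ 0 := (hL.sq_add_quarter_eq_zero_iff hzL).not.2 hz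
    refine ((hg z hzL).fun_div (((L.analyticOnNhd_weierstrassP z hzL).fun_pow 2).add
      analyticAt_const) hD).congr ?_
    filter_upwards [(isOpen_compl_lattice L).mem_nhds hzL] with x hx
    exact (hf x hx).symm
  refine ⟨⟨hL.linearIndependent_periods, fun z _ => ?_, hper _ hL.two_omega_mem,
    hper _ hL.two_I_omega_mem⟩, fun z => ⟨fun h => ?_, fun h => ?_⟩, hpole⟩
  · by_cases hz : z ∈ polePoints
    · have ho := hpole z hz
      have hzL := hL.notMem_of_mem_polePoints hz
      refine meromorphicNFAt_iff_analyticAt_or.2 (Or.inr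
        ⟨meromorphicAt_of_meromorphicOrderAt_ne_zero (by rw [ho]; decide),
          by rw [ho]; decide, ?_⟩)
      -- Division by zero yields the value `0` that the normal form prescribes at a pole.
      rw [hf z hzL, (hL.sq_add_quarter_eq_zero_iff hzL).2 hz, div_zero]
    · exact (hreg z hz).meromorphicNFAt
  · by_contra hz
    exact absurd (hreg z hz).meromorphicOrderAt_nonneg (not_le.2 h)
  · rw [hpole z h]
    decide

theorem isElliptic_scExt : IsElliptic (2 * omega) (2 * Complex.I * omega) (scExt L) ∧
    HasSimplePolesExactlyAt (scExt L) polePoints := by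
  refine hL.isElliptic_of_eq_div (g := fun z => -(1 / 2) * L.derivWeierstrassP z)
    (fun l hl z => ?_) analyticAt_scExt_zero
    (fun z hz => analyticAt_const.mul (L.analyticOnNhd_derivWeierstrassP z hz))
    (fun z hz hD => mul_ne_zero (by norm_num) (hL.derivWeierstrassP_ne_zero hz hD))
    fun x _ => (mul_div_assoc _ _ _).symm
  rw [scExt, scExt, L.weierstrassP_add_coe z ⟨l, hl⟩, L.derivWeierstrassP_add_coe z ⟨l, hl⟩]

theorem isElliptic_sqSExt : IsElliptic (2 * omega) (2 * Complex.I * omega) (sqSExt L) ∧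
    HasSimplePolesExactlyAt (sqSExt L) polePoints := by
  refine hL.isElliptic_of_eq_div (g := L.weierstrassP)
    (fun l hl z => ?_) analyticAt_sqSExt_zero L.analyticOnNhd_weierstrassP
    (fun z hz hD h => ?_) fun x _ => rfl
  · rw [sqSExt, sqSExt, L.weierstrassP_add_coe z ⟨l, hl⟩]
  · rw [h] at hD
    norm_num at hD

theorem isElliptic_sqCExt : IsElliptic (2 * omega) (2 * Complex.I * omega) (sqCExt L) ∧
    HasSimplePolesExactlyAt (sqCExt L) polePoints := by
  refine hL.isElliptic_of_eq_div (g := fun z => L.weierstrassP z ^ 2 - 1 / 4)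
    (fun l hl z => ?_) analyticAt_sqCExt_zero
    (fun z hz => ((L.analyticOnNhd_weierstrassP z hz).fun_pow 2).sub analyticAt_const)
    (fun z hz hD h => ?_) fun x hx => if_neg hx
  · have hmem : z + l ∈ L.lattice ↔ z ∈ L.lattice := add_mem_cancel_right hl
    rw [sqCExt, sqCExt, L.weierstrassP_add_coe z ⟨l, hl⟩]
    split_ifs with h₁ h₂ h₂
    · rfl
    · exact absurd (hmem.1 h₁) h₂
    · exact absurd (hmem.2 h₂) h₁
    · rfl
  · have : (1 : ℂ) / 2 = 0 := by linear_combination hD - h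
    norm_num at this

end

/-! ### Comparison of the solutions with the candidates -/

section

variable {U : Set ℂ} {s c : ℂ → ℂ} (hU : IsOpen U) (hUc : IsPreconnected U) (h0 : (0 : ℂ) ∈ U)
  (h : IsIVPSolution U s c)

include hL hU h0 h in
theorem scExt_eventuallyEq_mul : scExt L =ᶠ[𝓝 0] fun z => s z * c z := by
  refine eventuallyEq_of_deriv_deriv_eq (g := fun y => -8 * y ^ 3) (by fun_prop)
    analyticAt_scExt_zero ((h.analyticAt_s hU h0).mul (h.analyticAt_c hU h0)) ?_ ?_
    (by simp [h.s_zero]) ?_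
  · filter_upwards [eventually_regular_zero (L := L)] with z hz
    exact hL.deriv_deriv_scExt hz.1 hz.2.2
  · filter_upwards [nhdsWithin_le_nhds (hU.mem_nhds h0)] with z hz
    exact h.deriv_deriv_mul hU hz
  · rw [hL.deriv_scExt_zero, h.deriv_mul h0, h.s_zero, h.c_zero]
    norm_num

include hL hU hUc h0 h in
theorem sqExt_eventuallyEq : sqCExt L =ᶠ[𝓝[≠] 0] (fun z => c z ^ 2) ∧
    sqSExt L =ᶠ[𝓝[≠] 0] fun z => s z ^ 2 := by
  have e := hL.scExt_eventuallyEq_mul hU h0 h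
  have hC := analyticAt_sqCExt_zero (L := L)
  have hsum : ∀ᶠ z in 𝓝 0, c z ^ 2 + sqCExt L z ≠ 0 := by
    have : ContinuousAt (fun z => c z ^ 2 + sqCExt L z) 0 :=
      ((h.analyticAt_c hU h0).continuousAt.pow 2).add hC.continuousAt
    exact this.eventually_ne (by simp [h.c_zero])
  have hc0 : ∀ᶠ z in 𝓝 0, c z ≠ 0 :=
    (h.analyticAt_c hU h0).continuousAt.eventually_ne (by simp [h.c_zero])
  have key : ∀ᶠ z in 𝓝[≠] 0, sqCExt L z = c z ^ 2 ∧ sqSExt L z = s z ^ 2 := by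
    filter_upwards [eventually_regular_zero (L := L),
      nhdsWithin_le_nhds (hU.mem_nhds h0), e.eventuallyEq_nhds.filter_mono nhdsWithin_le_nhds,
      hsum.filter_mono nhdsWithin_le_nhds, hc0.filter_mono nhdsWithin_le_nhds]
      with z hz hzU he hz1 hz2
    have e₁ := (hL.hasDerivAt_scExt hz.1 hz.2.2).deriv
    rw [he.deriv_eq, h.deriv_mul hzU] at e₁
    have e₂ := sqSExt_sq_add_sqCExt_sq hz.1 hz.2.2
    have e₃ := h.pow_four_add hU hUc h0 hzU
    have e₄ : sqCExt L z = c z ^ 2 := by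
      refine mul_left_cancel₀ hz1 ?_
      -- The relations give `C² = c⁴`; the factor `c² + C` equals `2` at `0`, which selects `C =
      -- c²`.
      linear_combination (e₂ - e₃ - e₁) / 2
    refine ⟨e₄, mul_right_cancel₀ (pow_ne_zero 2 hz2) ?_⟩
    have e₅ := hL.scExt_sq hz.1
    rw [he.self_of_nhds, e₄] at e₅
    linear_combination -e₅
  exact ⟨key.mono fun _ h => h.1, key.mono fun _ h => h.2⟩

end

end IsLemniscatic

end Lemniscatic

theorem mainTheorem4 :
    (∃ L : PeriodPair, Lemniscatic.IsLemniscatic L) ∧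
    ∀ L : PeriodPair, Lemniscatic.IsLemniscatic L →
      L.lattice = Submodule.span ℤ
        {2 * (Lemniscatic.omega : ℂ), 2 * Complex.I * (Lemniscatic.omega : ℂ)} ∧
      ∀ (U : Set ℂ) (s c : ℂ → ℂ), IsOpen U → IsPreconnected U → (0 : ℂ) ∈ U →
        Lemniscatic.IsIVPSolution U s c →
        (∃ P : ℂ → ℂ,
          Lemniscatic.IsElliptic (2 * Lemniscatic.omega) (2 * Complex.I * Lemniscatic.omega) P ∧
          Set.EqOn P (fun z => s z * c z) U ∧
          Lemniscatic.HasSimplePolesExactlyAt P Lemniscatic.polePoints ∧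
          (∀ z : ℂ, z ∉ L.lattice → L.weierstrassP z ^ 2 + 1 / 4 ≠ 0 →
            P z = -(1 / 2) * (L.derivWeierstrassP z / (L.weierstrassP z ^ 2 + 1 / 4)))) ∧
        (∃ C : ℂ → ℂ,
          Lemniscatic.IsElliptic (2 * Lemniscatic.omega) (2 * Complex.I * Lemniscatic.omega) C ∧
          Set.EqOn C (fun z => c z ^ 2) U ∧
          Lemniscatic.HasSimplePolesExactlyAt C Lemniscatic.polePoints) ∧
        (∃ S : ℂ → ℂ,
          Lemniscatic.IsElliptic (2 * Lemniscatic.omega) (2 * Complex.I * Lemniscatic.omega) S ∧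
          Set.EqOn S (fun z => s z ^ 2) U ∧
          Lemniscatic.HasSimplePolesExactlyAt S Lemniscatic.polePoints) ∧
        (∀ z ∈ U, z ∉ L.lattice → L.weierstrassP z ^ 2 + 1 / 4 ≠ 0 ∧
          s z * c z = -(1 / 2) * (L.derivWeierstrassP z / (L.weierstrassP z ^ 2 + 1 / 4))) := by
  refine ⟨Lemniscatic.exists_isLemniscatic, fun L hL => ⟨hL.lattice_eq, fun U s c hU hUc h0 h => ?_⟩⟩
  have hs : ∀ z ∈ U, AnalyticAt ℂ s z := fun z hz => h.analyticAt_s hU hz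
  have hc : ∀ z ∈ U, AnalyticAt ℂ c z := fun z hz => h.analyticAt_c hU hz
  have hsc : ∀ z ∈ U, AnalyticAt ℂ (fun z => s z * c z) z := fun z hz => (hs z hz).mul (hc z hz)
  obtain ⟨hP, hPp⟩ := hL.isElliptic_scExt
  obtain ⟨hC, hCp⟩ := hL.isElliptic_sqCExt
  obtain ⟨hS, hSp⟩ := hL.isElliptic_sqSExt
  obtain ⟨eC, eS⟩ := hL.sqExt_eventuallyEq hU hUc h0 h
  have eP := (hL.scExt_eventuallyEq_mul hU h0 h).filter_mono
    (nhdsWithin_le_nhds (s := {0}ᶜ))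
  have hEq := Lemniscatic.eqOn_of_eventuallyEq_zero hUc h0 hP.meromorphic hsc eP
  refine ⟨⟨Lemniscatic.scExt L, hP, hEq, hPp, fun z _ _ => rfl⟩,
    ⟨Lemniscatic.sqCExt L, hC, Lemniscatic.eqOn_of_eventuallyEq_zero hUc h0 hC.meromorphic
      (fun z hz => (hc z hz).fun_pow 2) eC, hCp⟩,
    ⟨Lemniscatic.sqSExt L, hS, Lemniscatic.eqOn_of_eventuallyEq_zero hUc h0 hS.meromorphic
      (fun z hz => (hs z hz).fun_pow 2) eS, hSp⟩, fun z hz hzL => ⟨fun hD => ?_, ?_⟩⟩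
  -- A zero of `℘² + ¼` in `U` would be a pole of the extension, which agrees near it with the
  -- analytic function `sc`.
  · have hneg := (hPp.1 z).2 ((hL.sq_add_quarter_eq_zero_iff hzL).1 hD)
    rw [meromorphicOrderAt_congr (Lemniscatic.eventuallyEq_nhdsNE_of_isPreconnected hUc
      (fun x _ => Lemniscatic.meromorphic_scExt L x) (fun x hx => (hsc x hx).meromorphicAt) h0 hz eP)] at hneg
    exact absurd (hsc z hz).meromorphicOrderAt_nonneg (not_le.2 hneg)
  · exact (hEq hz).symm
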